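/- A family $\mathcal{A}$ of infinite subsets of $\omega$ is almost disjoint if any two distinct members of $\mathcal{A}$ have finite intersection; a MAD family is an infinite almost disjoint family that is maximal under inclusion among almost disjoint families. Let $\mathcal{I}(\mathcal{A})$ be the ideal of all $X\subseteq\omega$ such that $X\setminus\bigcup F$ is finite for some finite $F\subseteq\mathcal{A}$, and let $\mathcal{I}(\mathcal{A})^{+}=\mathcal{P}(\omega)\setminus\mathcal{I}(\mathcal{A})$. The family $\mathcal{A}$ is $+$-Ramsey if for every nonempty tree $T\subseteq\omega^{<\omega}$ such that $\{n\in\omega : s^{\frown}\langle n\rangle\in T\}\in\mathcal{I}(\mathcal{A})^{+}$ for every $s\in T$, there is an infinite branch $f\in[T]$ with $\operatorname{im}(f)\in\mathcal{I}(\mathcal{A})^{+}$. It is completely separable if every $X\in\mathcal{I}(\mathcal{A})^{+}$ contains some $A\in\mathcal{A}$. Let $\mathfrak{a}$ be the least size of a MAD family and $\mathfrak{s}$ the least size of a splitting family, that is, of a family $\mathcal{S}$ of infinite subsets of $\omega$ such that for every infinite $X\subseteq\omega$ there is $S\in\mathcal{S}$ with $X\cap S$ and $X\setminus S$ both infinite.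 **Theorem.** (In ZFC.) There is a $+$-Ramsey MAD family. Moreover, if $\mathfrak{s}\leq\mathfrak{a}$, then there is a $+$-Ramsey MAD family that is completely separable. -/

import Mathlib

/-- An almost disjoint family of infinite subsets of `ω`. -/
def IsAD (𝒜 : Set (Set ℕ)) : Prop :=
  (∀ A ∈ 𝒜, A.Infinite) ∧ 𝒜.Pairwise fun A B => (A ∩ B).Finite

/-- A MAD family: an infinite almost disjoint family that is maximal with respect to inclusion
among the almost disjoint families. (Finite maximal families such as `{ω}` are excluded, as
always in the theory of MAD families.) -/
def IsMAD (𝒜 : Set (Set ℕ)) : Prop :=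
  𝒜.Infinite ∧ Maximal IsAD 𝒜

/-- The ideal on `ω` generated by `𝒜` (and the finite sets): all sets that are almost covered by
a finite union of members of `𝒜`. -/
def genIdeal (𝒜 : Set (Set ℕ)) : Set (Set ℕ) :=
  {X | ∃ F : Set (Set ℕ), F ⊆ 𝒜 ∧ F.Finite ∧ (X \ ⋃₀ F).Finite}

/-- The sets that are positive with respect to the ideal generated by `𝒜`. -/
def positiveSets (𝒜 : Set (Set ℕ)) : Set (Set ℕ) :=
  (genIdeal 𝒜)ᶜ

/-- The set of immediate successors of the node `s` in the tree `T`. -/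
def treeSucc (T : Descriptive.tree ℕ) (s : List ℕ) : Set ℕ :=
  {n | s ++ [n] ∈ T}

/-- The initial segment `⟨f 0, …, f (n - 1)⟩` of `f`. -/
def initSeg (f : ℕ → ℕ) (n : ℕ) : List ℕ :=
  (List.range n).map f

/-- The infinite branches of the tree `T`. -/
def treeBranches (T : Descriptive.tree ℕ) : Set (ℕ → ℕ) :=
  {f | ∀ n, initSeg f n ∈ T}

/-- A (nonempty) tree all of whose nodes have a successor set in `𝒳`. -/
def IsBranchingTree (𝒳 : Set (Set ℕ)) (T : Descriptive.tree ℕ) : Prop :=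
  [] ∈ T ∧ ∀ s ∈ T, treeSucc T s ∈ 𝒳

/-- `𝒜` is `+`-Ramsey. -/
def IsPlusRamsey (𝒜 : Set (Set ℕ)) : Prop :=
  ∀ T : Descriptive.tree ℕ, IsBranchingTree (positiveSets 𝒜) T →
    ∃ f ∈ treeBranches T, Set.range f ∈ positiveSets 𝒜

/-- Every positive set contains a member of `𝒜`. -/
def IsCompletelySeparable (𝒜 : Set (Set ℕ)) : Prop :=
  ∀ X ∈ positiveSets 𝒜, ∃ A ∈ 𝒜, A ⊆ X

/-- `S` splits `X`. -/
def Splits (S X : Set ℕ) : Prop :=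
  (X ∩ S).Infinite ∧ (X \ S).Infinite

/-- A splitting family of infinite subsets of `ω`. -/
def IsSplittingFamily (𝒮 : Set (Set ℕ)) : Prop :=
  (∀ S ∈ 𝒮, S.Infinite) ∧ ∀ X : Set ℕ, X.Infinite → ∃ S ∈ 𝒮, Splits S X

/-- The almost disjointness number `𝔞`, the least size of a MAD family. -/
noncomputable def almostDisjointnessNumber : Cardinal.{0} :=
  sInf {κ | ∃ 𝒜 : Set (Set ℕ), IsMAD 𝒜 ∧ Cardinal.mk 𝒜 = κ}

/-- The splitting number `𝔰`, the least size of a splitting family. -/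
noncomputable def splittingNumber : Cardinal.{0} :=
  sInf {κ | ∃ 𝒮 : Set (Set ℕ), IsSplittingFamily 𝒮 ∧ Cardinal.mk 𝒮 = κ}

/-
Suppose first that `𝔞 < 𝔰`. Then every MAD family of size `𝔞` is `+`-Ramsey: each node of the tree
is given its own member of the family that meets its successors in an infinite set. Fewer than `𝔰`
obligations can be met along a single branch, so there is a branch that enters at each node the
member given to it and leaves any finitely many other members infinitely often at once.

Suppose now that `𝔰 ≤ 𝔞`. As in Shelah's construction of a completely separable MAD family, the
family is built in `𝔠` stages, and each new set `Z` carries a tag: a binary sequence, of length less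
than `𝔰`, that prescribes on which sides of the sets of a splitting family `e` the set `Z` almost
lies. Sets with incompatible tags are almost disjoint. A positive set is split by some `e β` into
two positive parts; taking the least such `β` and iterating gives a binary scheme of tags with
continuum many limit tags. Since fewer than continuum many sets have been built, some limit tag
`t` is extended by none of their tags. Fewer than `𝔰 ≤ 𝔞` of these sets have a tag that `t`
extends, so a new set with tag `t` can be chosen almost disjoint from all of them. For trees the
scheme is run through conditions (subtrees that are large in a weak sense) instead of positive
sets, and the tag of a limit branch shows that its range is positive. Cutting each new set into
infinitely many pieces makes every set that contains one of the new sets positive.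
-/

open Set Filter Cardinal

section Sets

variable {X Y : Set ℕ}

lemma finite_of_finite_diff_of_finite_inter (h : (X \ Y).Finite) (h' : (X ∩ Y).Finite) :
    X.Finite :=
  inter_union_sdiff X Y ▸ h'.union h

lemma finite_inter_sUnion {F : Set (Set ℕ)} (hF : F.Finite) (h : ∀ A ∈ F, (X ∩ A).Finite) :
    (X ∩ ⋃₀ F).Finite := by
  rw [sUnion_eq_biUnion, inter_iUnion₂]
  exact hF.biUnion h

lemma infinite_range_of_le {y : ℕ → ℕ} (h : ∀ n, n ≤ y n) : (range y).Infinite :=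
  infinite_of_forall_exists_gt fun n => ⟨y (n + 1), mem_range_self _, h (n + 1)⟩

lemma finite_range_diff {y : ℕ → ℕ} (h : ∀ᶠ n in atTop, y n ∈ X) : (range y \ X).Finite := by
  obtain ⟨N, hN⟩ := eventually_atTop.1 h
  refine ((finite_Iio N).image y).subset ?_
  rintro _ ⟨⟨n, rfl⟩, hn⟩
  exact mem_image_of_mem y (not_le.1 fun h => hn (hN n h))

/-- The set `S` or its complement, according to the Boolean `i`. -/
def side (S : Set ℕ) (i : Bool) : Set ℕ :=
  if i then S else Sᶜ

lemma mem_side_not {S : Set ℕ} {i : Bool} {n : ℕ} : n ∈ side S (!i) ↔ n ∉ side S i := by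
  cases i <;> simp [side]

lemma compl_side (S : Set ℕ) (i : Bool) : (side S i)ᶜ = side S (!i) :=
  Set.ext fun _ => mem_side_not.symm

/-- The pieces `piece Z 0, piece Z 1, …` are pairwise disjoint infinite subsets of an infinite set
`Z`; they are the images of the rows of `ℕ × ℕ` under the increasing enumeration of `Z`. -/
noncomputable def piece (Z : Set ℕ) (j : ℕ) : Set ℕ :=
  range fun k => Nat.nth (· ∈ Z) (Nat.pair j k)

variable {Z : Set ℕ}

lemma piece_subset (hZ : Z.Infinite) (j : ℕ) : piece Z j ⊆ Z :=
  range_subset_iff.2 fun _ => Nat.nth_mem_of_infinite hZ _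

lemma infinite_piece (hZ : Z.Infinite) (j : ℕ) : (piece Z j).Infinite :=
  infinite_range_of_injective fun _ _ h =>
    (Nat.pair_eq_pair.1 (Nat.nth_injective hZ h)).2

lemma disjoint_piece (hZ : Z.Infinite) {i j : ℕ} (h : i ≠ j) :
    Disjoint (piece Z i) (piece Z j) := by
  refine Set.disjoint_left.2 ?_
  rintro _ ⟨k, rfl⟩ ⟨l, hl⟩
  exact h (Nat.pair_eq_pair.1 (Nat.nth_injective hZ hl)).1.symm

lemma piece_injective (hZ : Z.Infinite) : Function.Injective (piece Z) := by
  intro i j h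
  by_contra hij
  have hdisj := disjoint_piece hZ hij
  rw [h, Set.disjoint_iff_inter_eq_empty, inter_self] at hdisj
  exact (infinite_piece hZ j).nonempty.ne_empty hdisj

lemma splits_piece_zero (hZ : Z.Infinite) : Splits (piece Z 0) Z := by
  refine ⟨(infinite_piece hZ 0).mono (subset_inter (piece_subset hZ 0) subset_rfl),
    (infinite_piece hZ 1).mono (subset_sdiff.2 ⟨piece_subset hZ 1, ?_⟩)⟩
  exact disjoint_piece hZ one_ne_zero

end Sets

section Ideal

variable {𝒜 ℬ : Set (Set ℕ)} {X Y : Set ℕ}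

lemma genIdeal_mono (h : 𝒜 ⊆ ℬ) : genIdeal 𝒜 ⊆ genIdeal ℬ :=
  fun _ ⟨F, hF, hfin, hX⟩ => ⟨F, hF.trans h, hfin, hX⟩

lemma positiveSets_anti (h : 𝒜 ⊆ ℬ) : positiveSets ℬ ⊆ positiveSets 𝒜 :=
  compl_subset_compl.2 (genIdeal_mono h)

lemma mem_genIdeal_of_subset (hX : X ∈ genIdeal 𝒜) (h : Y ⊆ X) : Y ∈ genIdeal 𝒜 :=
  let ⟨F, hF, hfin, hX⟩ := hX
  ⟨F, hF, hfin, hX.subset (sdiff_subset_sdiff_left h)⟩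

lemma positive_of_subset (hY : Y ∈ positiveSets 𝒜) (h : Y ⊆ X) : X ∈ positiveSets 𝒜 :=
  fun hX => hY (mem_genIdeal_of_subset hX h)

lemma mem_genIdeal_of_finite (hX : X.Finite) : X ∈ genIdeal 𝒜 :=
  ⟨∅, empty_subset _, finite_empty, hX.subset sdiff_subset⟩

lemma mem_genIdeal_of_mem (hX : X ∈ 𝒜) : X ∈ genIdeal 𝒜 :=
  ⟨{X}, singleton_subset_iff.2 hX, finite_singleton X, by simp⟩

lemma union_mem_genIdeal (hX : X ∈ genIdeal 𝒜) (hY : Y ∈ genIdeal 𝒜) :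
    X ∪ Y ∈ genIdeal 𝒜 := by
  obtain ⟨F, hF, hF', hX⟩ := hX
  obtain ⟨G, hG, hG', hY⟩ := hY
  refine ⟨F ∪ G, union_subset hF hG, hF'.union hG', ?_⟩
  rw [union_sdiff_distrib, sUnion_union]
  exact (hX.subset (sdiff_subset_sdiff_right subset_union_left)).union
    (hY.subset (sdiff_subset_sdiff_right subset_union_right))

lemma biUnion_mem_genIdeal {κ : Type*} {s : Set κ} (hs : s.Finite) {f : κ → Set ℕ}
    (hf : ∀ i ∈ s, f i ∈ genIdeal 𝒜) : (⋃ i ∈ s, f i) ∈ genIdeal 𝒜 := by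
  induction s, hs using Set.Finite.induction_on with
  | empty => simpa using mem_genIdeal_of_finite finite_empty
  | insert _ _ ih =>
    rw [biUnion_insert]
    exact union_mem_genIdeal (hf _ (mem_insert _ _)) (ih fun i hi => hf i (mem_insert_of_mem _ hi))

lemma positive_diff (hX : X ∈ positiveSets 𝒜) (hY : Y ∈ genIdeal 𝒜) :
    X \ Y ∈ positiveSets 𝒜 := fun h =>
  hX (mem_genIdeal_of_subset (union_mem_genIdeal h hY) (by simp))

lemma infinite_of_positive (hX : X ∈ positiveSets 𝒜) : X.Infinite :=
  fun h => hX (mem_genIdeal_of_finite h)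

lemma finite_inter_of_mem_genIdeal (hX : X ∈ genIdeal 𝒜) (hY : ∀ A ∈ 𝒜, (Y ∩ A).Finite) :
    (Y ∩ X).Finite := by
  obtain ⟨F, hF, hfin, hX⟩ := hX
  exact finite_of_finite_diff_of_finite_inter
    (hX.subset (sdiff_subset_sdiff_left inter_subset_right))
    ((finite_inter_sUnion hfin fun A hA => hY A (hF hA)).subset
      (inter_subset_inter_left _ inter_subset_left))

lemma positive_of_almostDisjoint (hX : X.Infinite) (h : ∀ A ∈ 𝒜, (X ∩ A).Finite) :
    X ∈ positiveSets 𝒜 := fun hI => hX (by simpa using finite_inter_of_mem_genIdeal hI h)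

lemma positive_of_infinite_hits (had : IsAD 𝒜)
    (h : {A ∈ 𝒜 | (X ∩ A).Infinite}.Infinite) : X ∈ positiveSets 𝒜 := by
  rintro ⟨F, hF, hfin, hX⟩
  obtain ⟨A, ⟨hA, hXA⟩, hAF⟩ := (h.sdiff hfin).nonempty
  have hAF' : (A ∩ ⋃₀ F).Finite :=
    finite_inter_sUnion hfin fun B hB => had.2 hA (hF hB) fun h => hAF (h ▸ hB)
  exact hXA (finite_of_finite_diff_of_finite_inter
    (hX.subset (sdiff_subset_sdiff_left inter_subset_left))
    (hAF'.subset (inter_subset_inter_left _ inter_subset_right)))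

lemma exists_almostDisjoint_of_finite_hits (hX : X ∈ positiveSets 𝒜)
    (h : {A ∈ 𝒜 | (X ∩ A).Infinite}.Finite) :
    ∃ Z ⊆ X, Z.Infinite ∧ ∀ A ∈ 𝒜, (Z ∩ A).Finite := by
  refine ⟨X \ ⋃₀ {A ∈ 𝒜 | (X ∩ A).Infinite}, sdiff_subset,
    fun hf => hX ⟨_, sep_subset _ _, h, hf⟩, fun A hA => ?_⟩
  by_cases hXA : (X ∩ A).Infinite
  · refine Set.finite_empty.subset ?_
    rintro n ⟨⟨-, hn⟩, hnA⟩
    exact hn ⟨A, ⟨hA, hXA⟩, hnA⟩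
  · exact (not_infinite.1 hXA).subset (inter_subset_inter_left _ sdiff_subset)

lemma exists_almostDisjoint_or_infinite_hits (hX : X ∈ positiveSets 𝒜) :
    (∃ Z ⊆ X, Z.Infinite ∧ ∀ A ∈ 𝒜, (Z ∩ A).Finite) ∨
      {A ∈ 𝒜 | (X ∩ A).Infinite}.Infinite :=
  or_iff_not_imp_right.2 fun h => exists_almostDisjoint_of_finite_hits hX (not_infinite.1 h)

lemma exists_positivity_test (had : IsAD 𝒜) (hX : X ∈ positiveSets 𝒜) :
    ∃ C : ℕ → Set ℕ, (∀ n, (C n).Infinite) ∧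
      ∀ D : Set ℕ, (∃ᶠ n in atTop, (C n ∩ D).Infinite) → X ∩ D ∈ positiveSets 𝒜 := by
  rcases exists_almostDisjoint_or_infinite_hits hX with ⟨Z, hZX, hZ, hZA⟩ | h
  · refine ⟨fun _ => Z, fun _ => hZ, fun D hD => ?_⟩
    obtain ⟨_, hZD⟩ := hD.exists
    exact positive_of_subset (positive_of_almostDisjoint hZD fun A hA =>
      (hZA A hA).subset (inter_subset_inter_left _ inter_subset_left))
      (inter_subset_inter_left _ hZX)
  · have A := h.natEmbedding
    refine ⟨fun n => X ∩ A n, fun n => (A n).2.2, fun D hD => positive_of_infinite_hits had ?_⟩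
    have hinf : ((fun n => (A n : Set ℕ)) '' {n | (X ∩ A n ∩ D).Infinite}).Infinite :=
      (Nat.frequently_atTop_iff_infinite.1 hD).image
        (Subtype.val_injective.comp A.injective).injOn
    refine hinf.mono ?_
    rintro _ ⟨n, hn, rfl⟩
    exact ⟨(A n).2.1, hn.mono (inter_right_comm _ _ _).subset⟩

section PseudoIntersection

variable {X : ℕ → Set ℕ}

lemma exists_pseudoIntersection_infinite_hits (hanti : Antitone X)
    (h : {A ∈ 𝒜 | ∀ n, (X n ∩ A).Infinite}.Infinite) :
    ∃ Y ⊆ X 0, {A ∈ 𝒜 | (Y ∩ A).Infinite}.Infinite ∧ ∀ n, (Y \ X n).Finite := by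
  have A := h.natEmbedding
  -- every member of the sequence `A` is visited infinitely often
  choose y hy hlt using fun n => ((A n.unpair.1).2.2 n).exists_gt n
  refine ⟨range y, range_subset_iff.2 fun n => hanti n.zero_le (hy n).1, ?_, fun n =>
    finite_range_diff (eventually_atTop.2 ⟨n, fun m hm => hanti hm (hy m).1⟩)⟩
  refine (infinite_range_of_injective (Subtype.val_injective.comp A.injective)).mono ?_
  rintro _ ⟨k, rfl⟩
  have hk : (range fun j => y (Nat.pair k j)).Infinite :=
    infinite_range_of_le fun j => (Nat.right_le_pair k j).trans (hlt _).le
  refine ⟨(A k).2.1, hk.mono (range_subset_iff.2 fun j => ⟨mem_range_self _, ?_⟩)⟩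
  simpa using (hy (Nat.pair k j)).2

lemma exists_pseudoIntersection_almostDisjoint (hanti : Antitone X)
    (hX : ∀ n, X n ∈ positiveSets 𝒜) (h : {A ∈ 𝒜 | ∀ n, (X n ∩ A).Infinite}.Finite) :
    ∃ Y ⊆ X 0, (Y.Infinite ∧ ∀ A ∈ 𝒜, (Y ∩ A).Finite) ∧ ∀ n, (Y \ X n).Finite := by
  have hU : ⋃₀ {A ∈ 𝒜 | ∀ n, (X n ∩ A).Infinite} ∈ genIdeal 𝒜 :=
    ⟨_, sep_subset _ _, h, by simp⟩
  choose y hy hlt using fun n => (infinite_of_positive (positive_diff (hX n) hU)).exists_gt n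
  have hYX : ∀ n, (range y \ X n).Finite := fun n =>
    finite_range_diff (eventually_atTop.2 ⟨n, fun m hm => hanti hm (hy m).1⟩)
  refine ⟨range y, range_subset_iff.2 fun n => hanti n.zero_le (hy n).1,
    ⟨infinite_range_of_le fun n => (hlt n).le, fun A hA => ?_⟩, hYX⟩
  by_cases hAX : ∀ n, (X n ∩ A).Infinite
  · refine Set.finite_empty.subset ?_
    rintro _ ⟨⟨n, rfl⟩, hn⟩
    exact (hy n).2 ⟨A, ⟨hA, hAX⟩, hn⟩
  · push Not at hAX
    obtain ⟨n, hn⟩ := hAX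
    exact finite_of_finite_diff_of_finite_inter
      ((hYX n).subset (sdiff_subset_sdiff_left inter_subset_left))
      (hn.subset fun _ hm => ⟨hm.2, hm.1.2⟩)

lemma exists_positive_pseudoIntersection (had : IsAD 𝒜) (hanti : Antitone X)
    (hX : ∀ n, X n ∈ positiveSets 𝒜) :
    ∃ Y ⊆ X 0, Y ∈ positiveSets 𝒜 ∧ ∀ n, (Y \ X n).Finite := by
  by_cases h : {A ∈ 𝒜 | ∀ n, (X n ∩ A).Infinite}.Infinite
  · obtain ⟨Y, hYX, hY, hdiff⟩ := exists_pseudoIntersection_infinite_hits hanti h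
    exact ⟨Y, hYX, positive_of_infinite_hits had hY, hdiff⟩
  · obtain ⟨Y, hYX, hY, hdiff⟩ :=
      exists_pseudoIntersection_almostDisjoint hanti hX (not_infinite.1 h)
    exact ⟨Y, hYX, positive_of_almostDisjoint hY.1 hY.2, hdiff⟩

end PseudoIntersection

/-- An almost disjoint family is nowhere maximal if below every positive set there is an infinite
set that is almost disjoint from all its members. -/
def IsNowhereMAD (𝒜 : Set (Set ℕ)) : Prop :=
  ∀ X ∈ positiveSets 𝒜, ∃ Z ⊆ X, Z.Infinite ∧ ∀ A ∈ 𝒜, (Z ∩ A).Finite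

lemma IsAD.mono (h : IsAD ℬ) (hsub : 𝒜 ⊆ ℬ) : IsAD 𝒜 :=
  ⟨fun A hA => h.1 A (hsub hA), h.2.mono hsub⟩

lemma IsAD.exists_infinite_inter_of_maximal (h : Maximal IsAD 𝒜) (hX : X.Infinite) :
    ∃ A ∈ 𝒜, (X ∩ A).Infinite := by
  by_contra! hcon
  have hX𝒜 : X ∉ 𝒜 := fun hmem => hX (by simpa using hcon X hmem)
  have had : IsAD (insert X 𝒜) := by
    refine ⟨forall_mem_insert.2 ⟨hX, h.1.1⟩, h.1.2.insert fun A hA _ => ⟨hcon A hA, ?_⟩⟩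
    rw [inter_comm]
    exact hcon A hA
  exact hX𝒜 (h.2 had (subset_insert X 𝒜) (mem_insert X 𝒜))

lemma IsAD.maximal_of_forall_exists (had : IsAD 𝒜)
    (h : ∀ X : Set ℕ, X.Infinite → ∃ A ∈ 𝒜, (X ∩ A).Infinite) : Maximal IsAD 𝒜 := by
  refine ⟨had, fun ℬ hℬ hsub B hB => ?_⟩
  obtain ⟨A, hA, hBA⟩ := h B (hℬ.1 B hB)
  by_contra hB𝒜
  exact hBA (hℬ.2 hB (hsub hA) fun h => hB𝒜 (h ▸ hA))

lemma exists_almostDisjoint_of_card_lt (had : IsAD 𝒜) (hinf : 𝒜.Infinite)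
    (hcard : #𝒜 < almostDisjointnessNumber) :
    ∃ Z : Set ℕ, Z.Infinite ∧ ∀ A ∈ 𝒜, (Z ∩ A).Finite := by
  by_contra! hcon
  exact notMem_of_lt_csInf' hcard ⟨𝒜, ⟨hinf, had.maximal_of_forall_exists hcon⟩, rfl⟩

lemma IsAD.preimage (had : IsAD 𝒜) {φ : ℕ → ℕ} (hφ : Function.Injective φ)
    (h : ∀ A ∈ 𝒜, (A ∩ range φ).Infinite) :
    IsAD (preimage φ '' 𝒜) ∧ InjOn (preimage φ) 𝒜 := by
  have hpre : ∀ A ∈ 𝒜, (φ ⁻¹' A).Infinite := fun A hA =>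
    .of_image φ (image_preimage_eq_inter_range ▸ h A hA)
  have hfin : ∀ A ∈ 𝒜, ∀ B ∈ 𝒜, A ≠ B → (φ ⁻¹' A ∩ φ ⁻¹' B).Finite := fun A hA B hB hne =>
    ((had.2 hA hB hne).preimage hφ.injOn : (φ ⁻¹' (A ∩ B)).Finite)
  refine ⟨⟨forall_mem_image.2 hpre, ?_⟩, fun A hA B hB hAB => ?_⟩
  · rintro _ ⟨A, hA, rfl⟩ _ ⟨B, hB, rfl⟩ hne
    exact hfin A hA B hB fun h => hne (h ▸ rfl)
  · by_contra hne
    have := hfin A hA B hB hne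
    rw [← hAB, inter_self] at this
    exact hpre A hA this

lemma IsAD.isNowhereMAD_of_card_lt (had : IsAD 𝒜) (hcard : #𝒜 < almostDisjointnessNumber) :
    IsNowhereMAD 𝒜 := by
  intro X hX
  refine (exists_almostDisjoint_or_infinite_hits hX).elim id fun h => ?_
  -- transfer the trace of the family on `X` to `ℕ`
  set φ : ℕ → ℕ := Nat.nth (· ∈ X)
  have hφ : Function.Injective φ := Nat.nth_injective (infinite_of_positive hX)
  have hran : range φ = X := Nat.range_nth_of_infinite (infinite_of_positive hX)
  obtain ⟨had', hinj⟩ := (had.mono (sep_subset 𝒜 fun A => (X ∩ A).Infinite)).preimage hφ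
    fun A hA => by rw [hran, inter_comm]; exact hA.2
  obtain ⟨Z, hZ, hZA⟩ := exists_almostDisjoint_of_card_lt had' (h.image hinj)
    ((mk_image_le.trans (mk_le_mk_of_subset (sep_subset _ _))).trans_lt hcard)
  have hZX : φ '' Z ⊆ X := hran ▸ image_subset_range φ Z
  refine ⟨φ '' Z, hZX, hZ.image hφ.injOn, fun A hA => ?_⟩
  by_cases hXA : (X ∩ A).Infinite
  · rw [← image_inter_preimage]
    exact (hZA _ ⟨A, ⟨hA, hXA⟩, rfl⟩).image φ
  · exact (not_infinite.1 hXA).subset (inter_subset_inter_left _ hZX)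

end Ideal

section Splitting

/-- A family of sets is unsplitting if below every infinite set there is an infinite set that is
split by no member. -/
def IsUnsplitting (𝒮 : Set (Set ℕ)) : Prop :=
  ∀ X : Set ℕ, X.Infinite → ∃ Y ⊆ X, Y.Infinite ∧ ∀ S ∈ 𝒮, ¬ Splits S Y

variable {S X Y : Set ℕ} {𝒮 𝒯 : Set (Set ℕ)}

lemma Splits.of_almostSubset (h : Splits S Y) (hYX : (Y \ X).Finite) : Splits S X := by
  have hYS : ∀ R : Set ℕ, (Y ∩ R).Infinite → (X ∩ R).Infinite := fun R hR hf =>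
    hR (finite_of_finite_diff_of_finite_inter
      (hYX.subset (sdiff_subset_sdiff_left inter_subset_left))
      (hf.subset fun n hn => ⟨hn.2, hn.1.2⟩))
  exact ⟨hYS S h.1, hYS Sᶜ h.2⟩

lemma splits_iff_forall_side : Splits S X ↔ ∀ i, (X ∩ side S i).Infinite :=
  ⟨fun h i => by cases i; exacts [h.2, h.1], fun h => ⟨h true, h false⟩⟩

lemma IsUnsplitting.mono (h : IsUnsplitting 𝒯) (hsub : 𝒮 ⊆ 𝒯) : IsUnsplitting 𝒮 := fun X hX =>
  let ⟨Y, hYX, hY, hS⟩ := h X hX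
  ⟨Y, hYX, hY, fun S hS' => hS S (hsub hS')⟩

lemma IsUnsplitting.not_isSplittingFamily (h : IsUnsplitting 𝒮) : ¬ IsSplittingFamily 𝒮 :=
  fun hs =>
    let ⟨Y, _, hY, hYS⟩ := h univ infinite_univ
    let ⟨S, hS, hsp⟩ := hs.2 Y hY
    hYS S hS hsp

lemma isUnsplitting_singleton (S : Set ℕ) : IsUnsplitting {S} := by
  intro X hX
  by_cases h : (X ∩ S).Infinite
  · refine ⟨X ∩ S, inter_subset_left, h, ?_⟩
    rintro _ rfl ⟨-, hdiff⟩
    exact hdiff (finite_empty.subset fun n hn => hn.2 hn.1.2)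
  · refine ⟨X, Subset.rfl, hX, ?_⟩
    rintro _ rfl ⟨hinter, -⟩
    exact h hinter

lemma exists_not_splits_of_card_lt (h : #𝒮 < splittingNumber) :
    ∃ Y : Set ℕ, Y.Infinite ∧ ∀ S ∈ 𝒮, ¬ Splits S Y := by
  by_contra! hcon
  have hcard : #{S ∈ 𝒮 | S.Infinite} < splittingNumber :=
    (mk_le_mk_of_subset (sep_subset _ _)).trans_lt h
  refine notMem_of_lt_csInf' hcard ⟨_, ⟨fun S hS => hS.2, fun X hX => ?_⟩, rfl⟩
  obtain ⟨S, hS, hsp⟩ := hcon X hX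
  exact ⟨S, ⟨hS, hsp.1.mono inter_subset_right⟩, hsp⟩

lemma Splits.of_image {φ : ℕ → ℕ} (h : Splits S (φ '' Y)) : Splits (φ ⁻¹' S) Y := by
  constructor
  · refine Infinite.of_image φ ?_
    rw [image_inter_preimage]
    exact h.1
  · refine Infinite.of_image φ (h.2.mono ?_)
    rintro _ ⟨⟨y, hy, rfl⟩, hyS⟩
    exact mem_image_of_mem φ ⟨hy, hyS⟩

lemma isUnsplitting_of_card_lt (h : #𝒮 < splittingNumber) : IsUnsplitting 𝒮 := by
  intro X hX
  obtain ⟨Y, hY, hYS⟩ :=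
    exists_not_splits_of_card_lt ((mk_image_le (f := preimage (Nat.nth (· ∈ X)))).trans_lt h)
  refine ⟨Nat.nth (· ∈ X) '' Y, image_subset_iff.2 fun n _ => Nat.nth_mem_of_infinite hX n,
    hY.image (Nat.nth_injective hX).injOn, fun S hS hsp => ?_⟩
  exact hYS _ (mem_image_of_mem _ hS) hsp.of_image

lemma isUnsplitting_iUnion_nat {𝒮 : ℕ → Set (Set ℕ)} (h : ∀ n, IsUnsplitting (𝒮 n)) :
    IsUnsplitting (⋃ n, 𝒮 n) := by
  intro X hX
  choose! r hrX hr hrS using h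
  let Y : ℕ → Set ℕ := fun n => Nat.rec X (fun n Y => r n Y) n
  have hYinf : ∀ n, (Y n).Infinite := fun n => by
    induction n with
    | zero => exact hX
    | succ n ih => exact hr n _ ih
  have hanti : Antitone Y := antitone_nat_of_succ_le fun n => hrX n _ (hYinf n)
  choose y hy hlt using fun n => (hYinf n).exists_gt n
  refine ⟨range y, range_subset_iff.2 fun n => hanti n.zero_le (hy n),
    infinite_range_of_le fun n => (hlt n).le, fun S hS hsp => ?_⟩
  obtain ⟨n, hn⟩ := mem_iUnion.1 hS
  refine hrS n (Y n) (hYinf n) S hn (hsp.of_almostSubset ?_)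
  exact finite_range_diff (eventually_atTop.2 ⟨n + 1, fun m hm => hanti hm (hy m)⟩)

lemma isUnsplitting_of_countable (h : 𝒮.Countable) : IsUnsplitting 𝒮 := by
  rcases 𝒮.eq_empty_or_nonempty with rfl | hne
  · exact (isUnsplitting_singleton ∅).mono (empty_subset _)
  · obtain ⟨S, rfl⟩ := h.exists_eq_range hne
    rw [← iUnion_singleton_eq_range]
    exact isUnsplitting_iUnion_nat fun n => isUnsplitting_singleton (S n)

lemma exists_isSplittingFamily_card_eq :
    ∃ 𝒮 : Set (Set ℕ), IsSplittingFamily 𝒮 ∧ #𝒮 = splittingNumber :=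
  csInf_mem (s := {κ | ∃ 𝒮 : Set (Set ℕ), IsSplittingFamily 𝒮 ∧ #𝒮 = κ})
    ⟨_, {S | S.Infinite}, ⟨fun _ hS => hS, fun X hX =>
      ⟨piece X 0, infinite_piece hX 0, splits_piece_zero hX⟩⟩, rfl⟩

lemma aleph0_lt_splittingNumber : ℵ₀ < splittingNumber := by
  obtain ⟨𝒮, hS, hcard⟩ := exists_isSplittingFamily_card_eq
  by_contra! h
  rw [← hcard, le_aleph0_iff_set_countable] at h
  exact (isUnsplitting_of_countable h).not_isSplittingFamily hS

end Splitting

section Blocks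

/-- The union of the intervals `[u k, u (k + 1))` with `k ∈ D`. -/
def blockUnion (u : ℕ → ℕ) (D : Set ℕ) : Set ℕ :=
  ⋃ k ∈ D, Ico (u k) (u (k + 1))

variable {u : ℕ → ℕ}

lemma disjoint_blockUnion (hu : StrictMono u) {D E : Set ℕ} (h : Disjoint D E) :
    Disjoint (blockUnion u D) (blockUnion u E) := by
  simp only [blockUnion, disjoint_iUnion_left, disjoint_iUnion_right]
  exact fun k hk l hl =>
    hu.monotone.pairwise_disjoint_on_Ico_succ fun hkl => Set.disjoint_left.1 h hl (hkl ▸ hk)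

lemma infinite_inter_blockUnion (hu : StrictMono u) {C D : Set ℕ} (hD : D.Infinite) {N : ℕ}
    (h : ∀ k ∈ D, N ≤ k → (C ∩ Ico (u k) (u (k + 1))).Nonempty) :
    (C ∩ blockUnion u D).Infinite := by
  refine infinite_of_forall_exists_gt fun b => ?_
  obtain ⟨k, hk, hkb⟩ := hD.exists_gt (max N b)
  obtain ⟨c, hc, hcu⟩ := h k hk ((le_max_left _ _).trans hkb.le)
  exact ⟨c, ⟨hc, mem_biUnion hk hcu⟩,
    (le_max_right _ _).trans_lt (hkb.trans_le (hu.le_apply.trans hcu.1))⟩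

lemma Splits.splits_blockUnion (hu : StrictMono u) {S E C : Set ℕ} (hS : Splits S E) {N : ℕ}
    (h : ∀ k ∈ E, N ≤ k → (C ∩ Ico (u k) (u (k + 1))).Nonempty) :
    Splits (blockUnion u S) C := by
  constructor
  · refine (infinite_inter_blockUnion hu hS.1 fun k hk => h k hk.1).mono
      (inter_subset_inter_right _ (biUnion_subset_biUnion_left inter_subset_right))
  · refine (infinite_inter_blockUnion hu hS.2 fun k hk => h k hk.1).mono fun n hn => ⟨hn.1, ?_⟩
    exact Set.disjoint_right.1 (disjoint_blockUnion hu disjoint_sdiff_right) hn.2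

/-- The endpoints of consecutive intervals that are long with respect to `g`. -/
def blockEnd (g : ℕ → ℕ) : ℕ → ℕ
  | 0 => 0
  | k + 1 => blockEnd g k + (Finset.range (blockEnd g k + 1)).sup g + 1

variable {g : ℕ → ℕ}

lemma strictMono_blockEnd : StrictMono (blockEnd g) :=
  strictMono_nat_of_lt_succ fun k => by simp only [blockEnd]; omega

lemma lt_blockEnd_succ {k n : ℕ} (h : n ≤ blockEnd g k) : g n < blockEnd g (k + 1) := by
  have : g n ≤ (Finset.range (blockEnd g k + 1)).sup g :=
    Finset.le_sup (f := g) (Finset.mem_range_succ_iff.2 h)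
  simp only [blockEnd]; omega

lemma exists_mem_Ico_blockEnd (n : ℕ) : ∃ k, n ∈ Ico (blockEnd g k) (blockEnd g (k + 1)) := by
  have hcover := iUnion_Ico_map_succ_eq_Ici (f := blockEnd g)
    (fun k => strictMono_blockEnd.monotone k.zero_le)
    strictMono_blockEnd.not_bddAbove_range_of_wellFoundedLT
  exact mem_iUnion.1 (hcover.ge n.zero_le)

/-- In other words, `𝔰 ≤ 𝔡`. -/
lemma exists_undominated {J : Type} (G : J → ℕ → ℕ) (hJ : #J < splittingNumber) :
    ∃ h : ℕ → ℕ, ∀ j, ∃ᶠ n in atTop, G j n < h n := by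
  obtain ⟨X, hX, hXS⟩ := exists_not_splits_of_card_lt
    ((mk_range_le (f := fun j => blockUnion (blockEnd (G j)) (piece univ 0))).trans_lt hJ)
  choose h hhX hlt using hX.exists_gt
  refine ⟨h, fun j hcon => hXS _ (mem_range_self j) ?_⟩
  simp only [not_lt, eventually_atTop] at hcon
  obtain ⟨N, hN⟩ := hcon
  refine (splits_piece_zero infinite_univ).splits_blockUnion strictMono_blockEnd (N := N)
    fun k _ hk => ⟨h (blockEnd (G j) k), hhX _, (hlt _).le, ?_⟩
  exact (hN _ (hk.trans strictMono_blockEnd.le_apply)).trans_lt (lt_blockEnd_succ le_rfl)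

/-- If `G` is unbounded, then infinitely many blocks of some `G β` contain an interval
`[m, H m]`. -/
lemma exists_infinite_long_blocks {ι : Type*} {G : ι → ℕ → ℕ}
    (hG : ∀ H : ℕ → ℕ, ∃ β, ∃ᶠ n in atTop, H n < G β n) (H : ℕ → ℕ) :
    ∃ β, {k | ∃ m, blockEnd (G β) k ≤ m ∧ H m < blockEnd (G β) (k + 1)}.Infinite := by
  obtain ⟨β, hβ⟩ := hG fun n => H (H n)
  refine ⟨β, infinite_of_forall_exists_gt fun b => ?_⟩
  obtain ⟨n, hn, hnG⟩ := frequently_atTop.1 hβ (blockEnd (G β) (b + 1))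
  obtain ⟨k, hkn, hnk⟩ := exists_mem_Ico_blockEnd (g := G β) n
  have hbk : b + 1 < k + 1 := strictMono_blockEnd.lt_iff_lt.1 (hn.trans_lt hnk)
  -- either `[n, H n]` lies in the block of `n`, or `[H n, H (H n)]` lies in the next one
  rcases lt_or_ge (H n) (blockEnd (G β) (k + 1)) with h | h
  · exact ⟨k, ⟨n, hkn, h⟩, Nat.lt_of_succ_lt_succ hbk⟩
  · exact ⟨k + 1, ⟨H n, h, hnG.trans (lt_blockEnd_succ hnk.le)⟩, Nat.lt_of_succ_lt hbk⟩

lemma exists_blockUnion_splits {ι : Type*} {G : ι → ℕ → ℕ}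
    (hG : ∀ H : ℕ → ℕ, ∃ β, ∃ᶠ n in atTop, H n < G β n) {𝒮 : Set (Set ℕ)}
    (hS : IsSplittingFamily 𝒮) {C : ℕ → Set ℕ} (hC : ∀ n, (C n).Infinite) :
    ∃ β, ∃ S ∈ 𝒮, ∀ n, Splits (blockUnion (blockEnd (G β)) S) (C n) := by
  choose c hcC hlt using fun n => (hC n).exists_gt
  obtain ⟨β, hβ⟩ := exists_infinite_long_blocks hG
    fun m => (Finset.range (m + 1)).sup fun n => c n m
  obtain ⟨S, hSS, hsp⟩ := hS.2 _ hβ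
  refine ⟨β, S, hSS, fun n => hsp.splits_blockUnion strictMono_blockEnd (N := n) ?_⟩
  rintro k ⟨m, hkm, hmk⟩ hnk
  have hnm : n ≤ m := hnk.trans (strictMono_blockEnd.le_apply.trans hkm)
  refine ⟨c n m, hcC n m, hkm.trans (hlt n m).le, lt_of_le_of_lt ?_ hmk⟩
  exact Finset.le_sup (f := fun n => c n m) (Finset.mem_range_succ_iff.2 hnm)

end Blocks

section Moves

lemma exists_bound_along_finite_succ {Q : Type*} {R : Q → Set Q} (hR : ∀ q, (R q).Finite)
    (g : Q → ℕ) : ∃ G : Q → ℕ → ℕ, ∀ play : ℕ → Q,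
      (∀ n, play (n + 1) ∈ R (play n)) → ∀ n, g (play n) ≤ G (play 0) n := by
  let reach : Q → ℕ → Set Q := fun q n => Nat.rec {q} (fun _ A => ⋃ q' ∈ A, R q') n
  have hfin : ∀ q n, (reach q n).Finite := fun q n => by
    induction n with
    | zero => exact finite_singleton q
    | succ n ih => exact ih.biUnion fun q' _ => hR q'
  choose G hG using fun q n => ((hfin q n).image g).bddAbove
  refine ⟨G, fun play hplay n => hG _ n (mem_image_of_mem g ?_)⟩
  induction n with
  | zero => exact mem_singleton _
  | succ n ih => exact mem_biUnion ih (hplay n)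

/-- In a game with countably many positions, in which the moves at a position `q` are the elements
of the infinite set `Z q`, moves can be prescribed in such a way that every play moves, infinitely
often, outside of any finitely many of fewer than `𝔰` forbidden sets, provided that these are
almost disjoint from the sets of moves. -/
lemma exists_moves {Q J : Type} [Countable Q] (hJ : #J < splittingNumber)
    {Z : Q → Set ℕ} (hZ : ∀ q, (Z q).Infinite) {succ : Q → ℕ → Set Q}
    (hsucc : ∀ q a, (succ q a).Finite) {M : J → Q → Set ℕ} (hM : ∀ j q, (Z q ∩ M j q).Finite) :
    ∃ move : ℕ → Q → ℕ, (∀ n q, move n q ∈ Z q ∧ n ≤ move n q) ∧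
      ∀ play : ℕ → Q, (∀ n, play (n + 1) ∈ succ (play n) (move n (play n))) →
        ∀ E : Finset J, ∃ᶠ n in atTop, ∀ j ∈ E, move n (play n) ∉ M j (play n) := by
  choose c hcZ hlt using fun q => (hZ q).exists_gt
  have hbdd : ∀ (E : Finset J) q, BddAbove (⋃ j ∈ E, Z q ∩ M j q) := fun E q =>
    (E.finite_toSet.biUnion fun j _ => hM j q).bddAbove
  choose g hg using hbdd
  have hlt_g : ∀ {E : Finset J} {j q m}, j ∈ E → c q m ∈ M j q → m < g E q :=
    fun hj hm => (hlt _ _).trans_le (hg _ _ (mem_biUnion hj ⟨hcZ _ _, hm⟩))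
  choose G hG using fun E : Finset J => exists_bound_along_finite_succ
    (R := fun q => ⋃ m ∈ Iio (g E q), succ q (c q m))
    (fun q => (finite_Iio _).biUnion fun m _ => hsucc q _) (g E)
  have hcard : #(Finset J × Q × ℕ) < splittingNumber := by
    classical
    rw [mk_prod, lift_id, lift_id]
    exact mul_lt_of_lt aleph0_lt_splittingNumber.le
      (((mk_le_of_surjective List.toFinset_surjective).trans (mk_list_le_max J)).trans_lt
        (max_lt aleph0_lt_splittingNumber hJ))
      (mk_le_aleph0.trans_lt aleph0_lt_splittingNumber)
  obtain ⟨h, hh⟩ :=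
    exists_undominated (fun (p : Finset J × Q × ℕ) n => G p.1 p.2.1 (n - p.2.2)) hcard
  refine ⟨fun n q => c q (max (h n) n),
    fun n q => ⟨hcZ _ _, (le_max_right _ _).trans (hlt _ _).le⟩, fun play hplay E hcon => ?_⟩
  simp only [not_forall, not_not, eventually_atTop] at hcon
  obtain ⟨N, hN⟩ := hcon
  have hmax : ∀ n, N ≤ n → max (h n) n < g E (play n) := fun n hn =>
    let ⟨j, hj, hmem⟩ := hN n hn
    hlt_g hj hmem
  obtain ⟨n, hn, hGn⟩ := frequently_atTop.1 (hh (E, play N, N)) N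
  have hgG := hG E (fun k => play (N + k))
    (fun k => mem_biUnion (hmax (N + k) (Nat.le_add_right N k)) (hplay (N + k))) (n - N)
  simp only [Nat.add_sub_cancel' hn, add_zero] at hgG
  exact absurd (hGn.trans ((le_max_left _ _).trans_lt (hmax n hn))) hgG.not_gt

end Moves

section Climbs

variable {P Q : Set (List ℕ)} {r s : List ℕ} {t : ℕ → List ℕ} {a : ℕ → ℕ}

/-- A climb through the set `P` of nodes above the node `s`: at stage `n` it extends the node `t n`
by the entry `a n`, and it passes through `t n ++ [a n] ∈ P` before it reaches `t (n + 1)`. The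
nodes `t n` themselves need not belong to `P`. -/
structure IsClimb (P : Set (List ℕ)) (s : List ℕ) (t : ℕ → List ℕ) (a : ℕ → ℕ) : Prop where
  prefix_zero : s <+: t 0
  mem : ∀ n, t n ++ [a n] ∈ P
  prefix_succ : ∀ n, t n ++ [a n] <+: t (n + 1)

lemma IsClimb.mono (h : IsClimb P s t a) (hPQ : P ⊆ Q) : IsClimb Q s t a :=
  ⟨h.prefix_zero, fun n => hPQ (h.mem n), h.prefix_succ⟩

lemma IsClimb.drop (h : IsClimb P s t a) {n : ℕ} (hr : r <+: t n) :
    IsClimb P r (fun k => t (k + n)) fun k => a (k + n) :=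
  ⟨by rwa [zero_add], fun k => h.mem (k + n), fun k => by
    rw [Nat.add_right_comm]
    exact h.prefix_succ (k + n)⟩

lemma IsClimb.prefix_of_le (h : IsClimb P s t a) {m n : ℕ} (hmn : m ≤ n) : t m <+: t n :=
  Nat.rel_of_forall_rel_succ_of_le (· <+: ·)
    (fun k => (List.prefix_append _ _).trans (h.prefix_succ k)) hmn

lemma IsClimb.strictMono_length (h : IsClimb P s t a) : StrictMono fun n => (t n).length :=
  strictMono_nat_of_lt_succ fun n => by
    have := (h.prefix_succ n).length_le
    rw [List.length_append, List.length_singleton] at this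
    exact this

lemma IsClimb.injective (h : IsClimb P s t a) : Function.Injective t :=
  fun _ _ hmn => h.strictMono_length.injective (congrArg List.length hmn)

lemma initSeg_prefix {f : ℕ → ℕ} {m n : ℕ} (h : m ≤ n) : initSeg f m <+: initSeg f n := by
  rw [initSeg, ← Nat.min_eq_left h, ← List.take_range, List.map_take]
  exact List.take_prefix _ _

lemma IsClimb.exists_eq_initSeg (h : IsClimb P s t a) :
    ∃ f : ℕ → ℕ, ∀ n, t n = initSeg f (t n).length := by
  have hlen : ∀ n, n < (t (n + 1)).length := fun n => h.strictMono_length.le_apply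
  refine ⟨fun k => (t (k + 1))[k]'(hlen k), fun n => List.ext_getElem (by simp [initSeg]) ?_⟩
  intro k hk _
  simp only [initSeg, List.getElem_map, List.getElem_range]
  rcases le_total n (k + 1) with hnk | hnk
  · exact (h.prefix_of_le hnk).getElem hk
  · exact ((h.prefix_of_le hnk).getElem (hlen k)).symm

lemma IsClimb.exists_branch {T : Descriptive.tree ℕ} (h : IsClimb {u | u ∈ T} s t a) :
    ∃ f ∈ treeBranches T, range a ⊆ range f := by
  obtain ⟨f, hf⟩ := h.exists_eq_initSeg
  refine ⟨f, fun n => ?_, range_subset_iff.2 fun n => ?_⟩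
  · have hn : initSeg f n <+: t n := by
      rw [hf n]
      exact initSeg_prefix h.strictMono_length.le_apply
    exact Descriptive.Tree.mem_of_prefix (hn.trans (List.prefix_append _ _)) (h.mem n)
  · have hmem : a n ∈ initSeg f (t (n + 1)).length :=
      hf (n + 1) ▸ (h.prefix_succ n).subset (by simp)
    obtain ⟨k, -, hk⟩ := List.mem_map.1 hmem
    exact ⟨k, hk⟩

end Climbs

section Conditions

variable {𝒜 : Set (Set ℕ)} {P Q : Set (List ℕ)} {X Y : Set ℕ} {r s : List ℕ}

/-- A condition is a set of nodes above each of whose elements there is a node that has positively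
many one-point extensions in the set. -/
def IsCondition (𝒜 : Set (Set ℕ)) (P : Set (List ℕ)) : Prop :=
  ∀ s ∈ P, ∃ t, s <+: t ∧ {a | t ++ [a] ∈ P} ∈ positiveSets 𝒜

lemma IsCondition.exists_climb (hP : IsCondition 𝒜 P) (hs : s ∈ P) {R : ℕ → List ℕ → Set ℕ}
    (hR : ∀ n t, {a | t ++ [a] ∈ P} ∈ positiveSets 𝒜 → ({a | t ++ [a] ∈ P} ∩ R n t).Nonempty) :
    ∃ t a, IsClimb P s t a ∧ ∀ n, a n ∈ R n (t n) := by
  choose t ht hpos using fun u : P => hP u u.2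
  choose a haP haR using fun n u => hR n (t u) (hpos u)
  let play : ℕ → P := fun n => Nat.rec ⟨s, hs⟩ (fun n u => ⟨t u ++ [a n u], haP n u⟩) n
  exact ⟨fun n => t (play n), fun n => a n (play n),
    ⟨ht (play 0), fun n => haP n (play n), fun n => ht (play (n + 1))⟩, fun n => haR n (play n)⟩

/-- The set `X` is null above the node `s` if every climb through `P` above `s` that avoids certain
sets in the ideal, one for each node, has only finitely many entries in `X`. -/
def IsNullAbove (𝒜 : Set (Set ℕ)) (P : Set (List ℕ)) (X : Set ℕ) (s : List ℕ) : Prop :=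
  ∃ M : List ℕ → Set ℕ, (∀ t, M t ∈ genIdeal 𝒜) ∧
    ∀ t a, IsClimb P s t a → ∀ᶠ n in atTop, a n ∈ X → a n ∈ M (t n)

lemma IsNullAbove.mono (h : IsNullAbove 𝒜 P X r) (hQP : Q ⊆ P) (hrs : r <+: s) :
    IsNullAbove 𝒜 Q X s := by
  obtain ⟨M, hM, hclimb⟩ := h
  exact ⟨M, hM, fun t a ht => hclimb t a ((ht.drop (hrs.trans ht.prefix_zero)).mono hQP)⟩

lemma IsCondition.not_isNullAbove_compl (hP : IsCondition 𝒜 P) (hs : s ∈ P)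
    (h : IsNullAbove 𝒜 P X s) : ¬ IsNullAbove 𝒜 P Xᶜ s := by
  rintro ⟨N, hN, hclimbN⟩
  obtain ⟨M, hM, hclimbM⟩ := h
  obtain ⟨t, a, hta, ha⟩ := hP.exists_climb hs (R := fun _ t => (M t ∪ N t)ᶜ) fun _ t hpos =>
    (infinite_of_positive (positive_diff hpos (union_mem_genIdeal (hM t) (hN t)))).nonempty
  obtain ⟨n, hnM, hnN⟩ := ((hclimbM t a hta).and (hclimbN t a hta)).exists
  by_cases hX : a n ∈ X
  · exact ha n (Or.inl (hnM hX))
  · exact ha n (Or.inr (hnN hX))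

/-- The nodes of `P` that end in an element of `X` and above which `X` is not null. -/
def kernel (𝒜 : Set (Set ℕ)) (P : Set (List ℕ)) (X : Set ℕ) : Set (List ℕ) :=
  {u ∈ P | (∃ t, ∃ a ∈ X, u = t ++ [a]) ∧ ¬ IsNullAbove 𝒜 P X u}

lemma exists_positive_kernel (h : ¬ IsNullAbove 𝒜 P X s) :
    ∃ t, s <+: t ∧ {a | t ++ [a] ∈ kernel 𝒜 P X} ∈ positiveSets 𝒜 := by
  by_contra! hcon
  have hnull : ∀ u, ∃ M : List ℕ → Set ℕ, (∀ t, M t ∈ genIdeal 𝒜) ∧ (IsNullAbove 𝒜 P X u →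
      ∀ t a, IsClimb P u t a → ∀ᶠ n in atTop, a n ∈ X → a n ∈ M (t n)) := fun u => by
    by_cases hu : IsNullAbove 𝒜 P X u
    · obtain ⟨M, hM, hclimb⟩ := hu
      exact ⟨M, hM, fun _ => hclimb⟩
    · exact ⟨fun _ => ∅, fun _ => mem_genIdeal_of_finite finite_empty, fun hu' => absurd hu' hu⟩
  choose M hM hclimb using hnull
  -- a climb that avoids these sets once, while in `X`, reaches a node above which `X` is null
  refine h ⟨fun t => {a | s <+: t ∧ t ++ [a] ∈ kernel 𝒜 P X} ∪ ⋃ u ∈ {u | u <+: t}, M u t,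
    fun t => union_mem_genIdeal ?_ (biUnion_mem_genIdeal ?_ fun u _ => hM u t),
    fun t a hta => ?_⟩
  · by_cases hst : s <+: t
    · simpa [hst] using not_not.1 (hcon t hst)
    · simpa [hst] using mem_genIdeal_of_finite finite_empty
  · simpa using List.finite_toSet t.inits
  · by_contra hfreq
    obtain ⟨n, hn⟩ := (not_eventually.1 hfreq).exists
    simp only [mem_union, not_or, Classical.not_imp, mem_ofPred_eq, not_and] at hn
    have hu : IsNullAbove 𝒜 P X (t n ++ [a n]) := by
      by_contra hu
      exact hn.2.1 (hta.prefix_zero.trans (hta.prefix_of_le n.zero_le))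
        ⟨hta.mem n, ⟨t n, a n, hn.1, rfl⟩, hu⟩
    have hev := hclimb _ hu _ _ (hta.drop (hta.prefix_succ n))
    rw [← map_add_atTop_eq_nat (n + 1)] at hfreq
    refine hfreq (eventually_map.2 (hev.mono fun k hk hX => Or.inr (mem_biUnion ?_ (hk hX))))
    exact (hta.prefix_succ n).trans (hta.prefix_of_le (Nat.le_add_left _ _))

lemma isCondition_kernel : IsCondition 𝒜 (kernel 𝒜 P X) := fun _ hs =>
  exists_positive_kernel hs.2.2

lemma kernel_subset : kernel 𝒜 P X ⊆ P := sep_subset _ _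

lemma isNullAbove_kernel (hXY : Disjoint X Y) : IsNullAbove 𝒜 (kernel 𝒜 P X) Y s := by
  refine ⟨fun _ => ∅, fun _ => mem_genIdeal_of_finite finite_empty,
    fun t a hta => Eventually.of_forall fun n hY => ?_⟩
  obtain ⟨-, ⟨u, b, hb, heq⟩, -⟩ := hta.mem n
  have hab : a n = b := by simpa using congrArg List.getLast? heq
  exact Set.disjoint_left.1 hXY hb (hab ▸ hY)

end Conditions

section SmallMAD

variable {𝒜 : Set (Set ℕ)}

lemma eventually_notMem_of_finite {a : ℕ → ℕ} (hle : ∀ n, n ≤ a n) {X : Set ℕ} (hX : X.Finite) :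
    ∀ᶠ n in atTop, a n ∉ X :=
  (tendsto_atTop_mono hle tendsto_id).eventually
    (Nat.cofinite_eq_atTop ▸ hX.eventually_cofinite_notMem)

lemma range_mem_positiveSets {J : Type*} {a : ℕ → ℕ} (hle : ∀ n, n ≤ a n) {B : J → ℕ → Set ℕ}
    (hcover : ∀ A ∈ 𝒜, ∃ j, ∀ᶠ n in atTop, a n ∈ A → a n ∈ B j n)
    (havoid : ∀ E : Finset J, ∃ᶠ n in atTop, ∀ j ∈ E, a n ∉ B j n) :
    range a ∈ positiveSets 𝒜 := by
  rintro ⟨F, hF, hfin, hrange⟩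
  have := hfin.to_subtype
  choose j hj using fun A : F => hcover A (hF A.2)
  obtain ⟨n, hn, hnj, hnF⟩ := ((havoid (finite_range j).toFinset).and_eventually
    ((eventually_all.2 hj).and (eventually_notMem_of_finite hle hrange))).exists
  refine hnF ⟨mem_range_self n, fun ⟨A, hA, hnA⟩ => ?_⟩
  exact hn (j ⟨A, hA⟩) (by simp) (hnj ⟨A, hA⟩ hnA)

lemma exists_injective_choice {Q α : Type*} [Countable Q] {C : Q → Set α}
    (hC : ∀ q, (C q).Infinite) : ∃ c : Q → α, Function.Injective c ∧ ∀ q, c q ∈ C q := by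
  classical
  obtain ⟨φ, hφ⟩ := exists_injective_nat Q
  choose D hDC hD using fun q => (hC q).exists_subset_card_eq (φ q + 1)
  obtain ⟨c, hc, hcD⟩ := (Finset.all_card_le_biUnion_card_iff_exists_injective D).1 fun s => by
    rcases s.eq_empty_or_nonempty with rfl | hs
    · simp
    · obtain ⟨q, hq, hmax⟩ := s.exists_max_image φ hs
      calc s.card = (s.image φ).card := (Finset.card_image_of_injective s hφ).symm
        _ ≤ (Finset.range (φ q + 1)).card := Finset.card_le_card fun n hn => by
            obtain ⟨r, hr, rfl⟩ := Finset.mem_image.1 hn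
            exact Finset.mem_range_succ_iff.2 (hmax r hr)
        _ = (D q).card := by rw [Finset.card_range, hD]
        _ ≤ (s.biUnion D).card := Finset.card_le_card (Finset.subset_biUnion_of_mem D hq)
  exact ⟨c, hc, fun q => hDC q (hcD q)⟩

lemma IsMAD.infinite_hits (h : IsMAD 𝒜) {X : Set ℕ} (hX : X ∈ positiveSets 𝒜) :
    {A ∈ 𝒜 | (X ∩ A).Infinite}.Infinite := by
  refine (exists_almostDisjoint_or_infinite_hits hX).resolve_left ?_
  rintro ⟨Z, -, hZ, hZA⟩
  obtain ⟨A, hA, hZA'⟩ := IsAD.exists_infinite_inter_of_maximal h.2 hZ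
  exact hZA' (hZA A hA)

theorem IsMAD.isPlusRamsey_of_card_lt (h : IsMAD 𝒜) (hcard : #𝒜 < splittingNumber) :
    IsPlusRamsey 𝒜 := by
  classical
  rintro T ⟨hroot, hT⟩
  obtain ⟨c, hcinj, hc⟩ := exists_injective_choice fun s : T => h.infinite_hits (hT s s.2)
  -- at the node `s` the branch enters `c s`, and it avoids the members other than `c s`
  have hM : ∀ (A : 𝒜) (s : T), (treeSucc T s ∩ c s ∩ {n ∈ (A : Set ℕ) | A ≠ c s}).Finite := by
    intro A s
    by_cases hA : (A : Set ℕ) = c s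
    · simp [hA]
    · exact (h.2.1.2 (hc s).1 A.2 (Ne.symm hA)).subset fun n hn => ⟨hn.1.2, hn.2.1⟩
  obtain ⟨move, hmove, hplay⟩ := exists_moves hcard (fun s : T => (hc s).2)
    (succ := fun s a => {t | t.1 = s.1 ++ [a]})
    (fun s a => Subsingleton.finite fun t ht u hu => Subtype.ext (Eq.trans ht (Eq.symm hu))) hM
  let play : ℕ → T := fun n => Nat.rec ⟨[], hroot⟩
    (fun n s => ⟨s.1 ++ [move n s], (hmove n s).1.1⟩) n
  have hclimb : IsClimb {u | u ∈ T} [] (fun n => (play n).1) fun n => move n (play n) :=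
    ⟨List.nil_prefix, fun n => (hmove n (play n)).1.1, fun n => List.prefix_rfl⟩
  obtain ⟨f, hf, hrange⟩ := hclimb.exists_branch
  refine ⟨f, hf, positive_of_subset (range_mem_positiveSets (fun n => (hmove n (play n)).2)
    (fun A hA => ⟨⟨A, hA⟩, ?_⟩) (hplay play fun n => rfl)) hrange⟩
  have hne : ∀ᶠ n in atTop, c (play n) ≠ A := by
    rw [← Nat.cofinite_eq_atTop]
    exact (hcinj.comp (Function.Injective.of_comp hclimb.injective)).tendsto_cofinite.eventually
      (finite_singleton A).eventually_cofinite_notMem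
  exact hne.mono fun n hn hA' => ⟨hA', hn.symm⟩

end SmallMAD

section Tags

variable {ι : Type*}

/-- A binary sequence indexed by the elements of `ι` below `length`, the tag of an almost disjoint
set: it records on which side of each of the first splitting sets the given set almost lies. The
signs at and above `length` are irrelevant. -/
structure Tag (ι : Type*) where
  length : ι
  sign : ι → Bool

namespace Tag

section Order

variable [LinearOrder ι] {r s t : Tag ι} {i j : Bool}

instance : Preorder (Tag ι) where
  le s t := s.length ≤ t.length ∧ ∀ β < s.length, s.sign β = t.sign β
  le_refl _ := ⟨le_rfl, fun _ _ => rfl⟩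
  le_trans _ _ _ h h' :=
    ⟨h.1.trans h'.1, fun β hβ => (h.2 β hβ).trans (h'.2 β (hβ.trans_le h.1))⟩

lemma exists_sign_eq_not (hst : ¬ s ≤ t) (hts : ¬ t ≤ s) :
    ∃ β < s.length, β < t.length ∧ s.sign β = !t.sign β := by
  by_contra! hcon
  have hagree : ∀ β < s.length, β < t.length → s.sign β = t.sign β :=
    fun β hs ht => Bool.ne_not.1 (hcon β hs ht)
  rcases le_total s.length t.length with h | h
  · exact hst ⟨h, fun β hβ => hagree β hβ (hβ.trans_le h)⟩
  · exact hts ⟨h, fun β hβ => (hagree β (hβ.trans_le h) hβ).symm⟩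

lemma le_of_length_le (hr : r ≤ t) (hs : s ≤ t) (h : r.length ≤ s.length) : r ≤ s :=
  ⟨h, fun β hβ => (hr.2 β hβ).trans (hs.2 β (hβ.trans_le h)).symm⟩

/-- The tag `t` extends the sequence `s` followed by the sign `i`. -/
def IsStep (s : Tag ι) (i : Bool) (t : Tag ι) : Prop :=
  s ≤ t ∧ s.length < t.length ∧ t.sign s.length = i

lemma IsStep.eq_of_le {t' : Tag ι} (h : s.IsStep i t) (h' : s.IsStep j t') (hr : t ≤ r)
    (hr' : t' ≤ r) : i = j := by
  rw [← h.2.2, ← h'.2.2, hr.2 _ h.2.1, hr'.2 _ h'.2.1]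

end Order

variable [LinearOrder ι] [WellFoundedLT ι]

lemma exists_limit {t : ℕ → Tag ι} (hmono : Monotone t)
    (hlt : ∀ n, (t n).length < (t (n + 1)).length) (hbdd : ∃ b, ∀ n, (t n).length < b) :
    ∃ l : Tag ι, (∀ n, t n ≤ l) ∧ ∀ β < l.length, ∃ n, β < (t n).length := by
  classical
  obtain ⟨l, hl, hmin⟩ := wellFounded_lt.has_min {b | ∀ n, (t n).length < b} hbdd
  have hleast : ∀ β < l, ∃ n, β < (t n).length := fun β hβ => by
    by_contra! hcon
    exact hmin β (fun n => (hlt n).trans_le (hcon (n + 1))) hβ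
  refine ⟨⟨l, fun β => if h : ∃ n, β < (t n).length then (t (Nat.find h)).sign β else true⟩,
    fun n => ⟨(hl n).le, fun β hβ => ?_⟩, hleast⟩
  have h : ∃ n, β < (t n).length := ⟨n, hβ⟩
  simp only [dif_pos h]
  exact ((hmono (Nat.find_min' h hβ)).2 β (Nat.find_spec h)).symm

/-- Distinct branches of a binary scheme of tags are not extended by the same tag, and there are
continuum many branches. -/
lemma exists_fresh_branch {τ : List Bool → Tag ι} (hτ : ∀ u i, (τ u).IsStep i (τ (i :: u)))
    (hbdd : ∀ u : ℕ → ι, ∃ b, ∀ n, u n < b) {κ : Type} (hκ : #κ < 𝔠) (tag : κ → Tag ι) :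
    ∃ (x : ℕ → Bool) (t : Tag ι), (∀ n, τ (PiNat.res x n) ≤ t) ∧
      (∀ β < t.length, ∃ n, β < (τ (PiNat.res x n)).length) ∧ ∀ k, ¬ t ≤ tag k := by
  have hstep : ∀ x n, (τ (PiNat.res x n)).IsStep (x n) (τ (PiNat.res x (n + 1))) :=
    fun x n => hτ _ _
  choose t hle hlim using fun x => exists_limit (t := fun n => τ (PiNat.res x n))
    (monotone_nat_of_le_succ fun n => (hstep x n).1) (fun n => (hstep x n).2.1) (hbdd _)
  suffices h : ∃ x, ∀ k, ¬ t x ≤ tag k from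
    let ⟨x, hx⟩ := h
    ⟨x, t x, hle x, hlim x, hx⟩
  by_contra! hcon
  choose k hk using hcon
  have hinj : Function.Injective k := by
    refine fun x y hxy => PiNat.res_injective (funext fun n => ?_)
    induction n with
    | zero => rfl
    | succ n ih =>
      have hy := hstep y n
      rw [← ih] at hy
      have hsign : x n = y n :=
        (hstep x n).eq_of_le hy ((hle x _).trans (hk x)) ((hle y _).trans (hxy ▸ hk y))
      rw [PiNat.res_succ, PiNat.res_succ, ih, hsign]
  refine (mk_le_of_injective hinj).not_gt ?_
  simpa using hκ

end Tag

end Tags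

section SplitNotions

variable {P ι : Type*}

/-- A notion of when the splitting set of index `β` splits the object `p`: at each index `p` is hit
on at least one side, and at some index it is hit on both sides. -/
structure SplitNotion (P ι : Type*) where
  hit : P → ι → Bool → Prop
  hit_or_hit_not : ∀ p β i, hit p β i ∨ hit p β (!i)
  exists_hit : ∀ p, ∃ α, ∀ i, hit p α i

namespace SplitNotion

variable [LinearOrder ι] [WellFoundedLT ι] (N : SplitNotion P ι) {p q : P} {β : ι} {i : Bool}

open Classical in
/-- The tag of `p`: its length is the first index at which `p` is hit on both sides, and its signs
are the sides on which `p` is hit below that index. -/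
noncomputable def tag (p : P) : Tag ι where
  length := wellFounded_lt.min {α | ∀ i, N.hit p α i} (N.exists_hit p)
  sign β := decide (N.hit p β true)

lemma hit_length (p : P) (i : Bool) : N.hit p (N.tag p).length i :=
  wellFounded_lt.min_mem _ (N.exists_hit p) i

lemma sign_eq_of_not_hit (h : ¬ N.hit p β (!i)) : (N.tag p).sign β = i := by
  cases i
  · simpa [tag] using h
  · simpa [tag] using (N.hit_or_hit_not p β true).resolve_right h

lemma not_hit_of_lt (h : β < (N.tag p).length) : ¬ N.hit p β (!(N.tag p).sign β) := by
  intro hit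
  have hsome : ¬ ∀ i, N.hit p β i := fun hall =>
    wellFounded_lt.not_lt_min {α | ∀ i, N.hit p α i} hall h
  obtain ⟨i, hi⟩ := not_forall.1 hsome
  have hsign : (N.tag p).sign β = !i := N.sign_eq_of_not_hit (by rwa [Bool.not_not])
  rw [hsign, Bool.not_not] at hit
  exact hi hit

/-- The object `q` is hit only where `p` is hit, and where `p` is first hit on both sides, it is
hit on the side `i` only. -/
def Step (p : P) (i : Bool) (q : P) : Prop :=
  (∀ β j, N.hit q β j → N.hit p β j) ∧ ¬ N.hit q (N.tag p).length (!i)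

variable {N}

lemma Step.isStep_tag (h : N.Step p i q) : (N.tag p).IsStep i (N.tag q) := by
  have hlt : (N.tag p).length < (N.tag q).length := by
    refine lt_of_not_ge fun hle => ?_
    rcases hle.lt_or_eq with hlt | heq
    · exact N.not_hit_of_lt hlt (h.1 _ _ (N.hit_length q _))
    · exact h.2 (heq ▸ N.hit_length q _)
  exact ⟨⟨hlt.le, fun β hβ =>
    (N.sign_eq_of_not_hit fun hq => N.not_hit_of_lt hβ (h.1 _ _ hq)).symm⟩, hlt,
    N.sign_eq_of_not_hit h.2⟩

end SplitNotion

end SplitNotions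

section SplitSystems

/-- A splitting family `e`, indexed by a linear order in which proper initial segments have fewer
than `𝔰` elements and countable sets are bounded. Moreover, the family either splits all members of
any given sequence of infinite sets at once, or its index set is so small that any functions
indexed by it are eventually dominated by a single one. -/
structure IsSplitSystem {ι : Type} [LinearOrder ι] (e : ι → Set ℕ) : Prop where
  bounded : ∀ u : ℕ → ι, ∃ b, ∀ n, u n < b
  card_Iic : ∀ b : ι, #(Iic b) < splittingNumber
  splits : ∀ X : Set ℕ, X.Infinite → ∃ α, Splits (e α) X
  split_all_or_dominated :
    (∀ C : ℕ → Set ℕ, (∀ n, (C n).Infinite) → ∃ α, ∀ n, Splits (e α) (C n)) ∨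
    ∀ G : ι → ℕ → ℕ, ∃ H : ℕ → ℕ, ∀ β, ∀ᶠ n in atTop, G β n ≤ H n

theorem exists_isSplitSystem :
    ∃ (ι : Type) (_ : LinearOrder ι) (_ : WellFoundedLT ι) (e : ι → Set ℕ), IsSplitSystem e := by
  obtain ⟨𝒮, hS, hcard⟩ := exists_isSplittingFamily_card_eq
  let ι := splittingNumber.ord.ToType
  have hι : #ι = splittingNumber := mk_ord_toType _
  have hIic : ∀ b : ι, #(Iic b) < splittingNumber := fun b => by
    have := mk_Iic_lt b (by rw [hι, Ordinal.type_toType]) (hι ▸ aleph0_lt_splittingNumber.le)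
    rwa [hι] at this
  obtain ⟨φ⟩ : Nonempty (ι ≃ 𝒮) := Cardinal.eq.1 (hι.trans hcard.symm)
  have hsplit : ∀ X : Set ℕ, X.Infinite → ∃ α, Splits (φ α) X := fun X hX =>
    let ⟨S, hS', h⟩ := hS.2 X hX
    ⟨φ.symm ⟨S, hS'⟩, by simpa using h⟩
  have hbdd : ∀ u : ℕ → ι, ∃ b, ∀ n, u n < b := fun u => by
    by_contra! hcon
    refine IsUnsplitting.not_isSplittingFamily (IsUnsplitting.mono (isUnsplitting_iUnion_nat
      fun n => isUnsplitting_of_card_lt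
        ((mk_image_le (f := fun β => (φ β : Set ℕ))).trans_lt (hIic (u n)))) fun S hS' => ?_) hS
    obtain ⟨n, hn⟩ := hcon (φ.symm ⟨S, hS'⟩)
    exact mem_iUnion.2 ⟨n, _, hn, by simp⟩
  by_cases hdom : ∀ G : ι → ℕ → ℕ, ∃ H : ℕ → ℕ, ∀ β, ∀ᶠ n in atTop, G β n ≤ H n
  · exact ⟨ι, inferInstance, inferInstance, fun α => φ α, hbdd, hIic, hsplit, Or.inr hdom⟩
  · push Not at hdom
    obtain ⟨G, hG⟩ := hdom
    obtain ⟨ψ⟩ : Nonempty (ι ≃ ι × 𝒮) := Cardinal.eq.1 (by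
      rw [mk_prod, lift_id, lift_id, hι, hcard, mul_eq_self aleph0_lt_splittingNumber.le])
    have hall : ∀ C : ℕ → Set ℕ, (∀ n, (C n).Infinite) →
        ∃ α, ∀ n, Splits (blockUnion (blockEnd (G (ψ α).1)) (ψ α).2) (C n) := fun C hC =>
      let ⟨β, S, hS', h⟩ := exists_blockUnion_splits hG hS hC
      ⟨ψ.symm (β, ⟨S, hS'⟩), by simpa using h⟩
    exact ⟨ι, inferInstance, inferInstance, _, hbdd, hIic,
      fun X hX => (hall (fun _ => X) fun _ => hX).imp fun _ h => h 0, Or.inl hall⟩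

lemma not_splits_range {S : Set ℕ} {i : Bool} {y : ℕ → ℕ} (h : ∀ᶠ n in atTop, y n ∉ side S i) :
    ¬ Splits S (range y) := fun hS =>
  splits_iff_forall_side.1 hS i <| by
    simpa [sdiff_compl] using finite_range_diff (X := (side S i)ᶜ) h

lemma exists_eventual_bound {J Q : Type*} [Countable Q]
    (hdom : ∀ G : J → ℕ → ℕ, ∃ H : ℕ → ℕ, ∀ j, ∀ᶠ n in atTop, G j n ≤ H n)
    {M : J → Q → Set ℕ} (hM : ∀ j q, (M j q).Finite) :
    ∃ H : Q → ℕ, ∀ j, ∀ᶠ q in cofinite, ∀ a ∈ M j q, a < H q := by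
  obtain ⟨φ, hφ⟩ := exists_injective_nat Q
  have hfin : ∀ j n, (⋃ q ∈ φ ⁻¹' {n}, M j q).Finite := fun j n =>
    ((finite_singleton n).preimage hφ.injOn).biUnion fun q _ => hM j q
  choose G hG using fun j n => (hfin j n).bddAbove
  obtain ⟨H, hH⟩ := hdom G
  refine ⟨fun q => H (φ q) + 1, fun j => ?_⟩
  filter_upwards [hφ.tendsto_cofinite.eventually (Nat.cofinite_eq_atTop ▸ hH j)] with q hq a ha
  exact Nat.lt_succ_of_le ((hG j (φ q) (mem_biUnion rfl ha)).trans hq)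

variable {ι : Type} [LinearOrder ι] {e : ι → Set ℕ} {𝒜 : Set (Set ℕ)}

lemma IsSplitSystem.exists_frequently_split (he : IsSplitSystem e) {C : ℕ → Set ℕ}
    (hC : ∀ n, (C n).Infinite) : ∃ α, ∀ i, ∃ᶠ n in atTop, (C n ∩ side (e α) i).Infinite := by
  rcases he.split_all_or_dominated with hall | hdom
  · exact (hall C hC).imp fun α hα i =>
      Frequently.of_forall fun n => splits_iff_forall_side.1 (hα n) i
  · by_contra! hcon
    choose i hi using hcon
    obtain ⟨H, hH⟩ := exists_eventual_bound hdom
      (M := fun α n => {a ∈ C n ∩ side (e α) (i α) | (C n ∩ side (e α) (i α)).Finite})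
      fun α n => by
        by_cases h : (C n ∩ side (e α) (i α)).Finite
        · exact h.subset (sep_subset _ _)
        · simp [h]
    choose y hyC hy using fun n => (hC n).exists_gt (max n (H n))
    obtain ⟨α, hα⟩ := he.splits _ (infinite_range_of_le fun n => (le_max_left _ _).trans (hy n).le)
    refine not_splits_range (i := i α) ?_ hα
    filter_upwards [hi α, Nat.cofinite_eq_atTop ▸ hH α] with n hfin hlt hmem
    exact (hlt _ ⟨⟨hyC n, hmem⟩, hfin⟩).not_ge ((le_max_right _ _).trans (hy n).le)

lemma IsSplitSystem.exists_split_positive (he : IsSplitSystem e) (had : IsAD 𝒜) {X : Set ℕ}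
    (hX : X ∈ positiveSets 𝒜) : ∃ α, ∀ i, X ∩ side (e α) i ∈ positiveSets 𝒜 :=
  let ⟨_, hC, htest⟩ := exists_positivity_test had hX
  (he.exists_frequently_split hC).imp fun _ hα i => htest _ (hα i)

variable {P : Set (List ℕ)} {s : List ℕ}

lemma IsCondition.exists_moveSets (hP : IsCondition 𝒜 P) (hs : s ∈ P) (hnm : IsNowhereMAD 𝒜) :
    ∃ C : List ℕ → Set ℕ, (∀ t, (C t).Infinite ∧ ∀ A ∈ 𝒜, (C t ∩ A).Finite) ∧
      ∀ t, {a | t ++ [a] ∈ P} ∈ positiveSets 𝒜 → C t ⊆ {a | t ++ [a] ∈ P} := by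
  obtain ⟨_, -, hpos⟩ := hP s hs
  have hC : ∀ t, ∃ C : Set ℕ, (C.Infinite ∧ ∀ A ∈ 𝒜, (C ∩ A).Finite) ∧
      ({a | t ++ [a] ∈ P} ∈ positiveSets 𝒜 → C ⊆ {a | t ++ [a] ∈ P}) := fun t => by
    by_cases ht : {a | t ++ [a] ∈ P} ∈ positiveSets 𝒜
    · obtain ⟨C, hCP, hC⟩ := hnm _ ht
      exact ⟨C, hC, fun _ => hCP⟩
    · obtain ⟨C, -, hC⟩ := hnm _ hpos
      exact ⟨C, hC, fun ht' => absurd ht' ht⟩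
  choose C hC hCP using hC
  exact ⟨C, hC, hCP⟩

lemma IsSplitSystem.exists_split_condition (he : IsSplitSystem e) (hnm : IsNowhereMAD 𝒜)
    (hP : IsCondition 𝒜 P) (hs : s ∈ P) :
    ∃ α, ∀ i, ¬ IsNullAbove 𝒜 P (side (e α) i) s := by
  obtain ⟨C, hC, hCP⟩ := hP.exists_moveSets hs hnm
  rcases he.split_all_or_dominated with hall | hdom
  · obtain ⟨α, hα⟩ := hall (fun n => C (Denumerable.ofNat (List ℕ) n)) fun n => (hC _).1
    refine ⟨α, fun i ⟨M, hM, hnull⟩ => ?_⟩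
    have hmove : ∀ t, ((C t ∩ side (e α) i) \ M t).Nonempty := fun t => by
      have hsplit : Splits (e α) (C t) := by simpa using hα (Encodable.encode t)
      refine ((splits_iff_forall_side.1 hsplit i).sdiff
        (finite_inter_of_mem_genIdeal (hM t) (hC t).2)).nonempty.mono ?_
      exact fun a ha => ⟨ha.1, fun haM => ha.2 ⟨ha.1.1, haM⟩⟩
    obtain ⟨t, a, hta, ha⟩ := hP.exists_climb hs (R := fun _ t => (C t ∩ side (e α) i) \ M t)
      fun _ t ht => (hmove t).mono fun a ha => ⟨hCP t ht ha.1.1, ha⟩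
    obtain ⟨n, hn⟩ := (hnull t a hta).exists
    exact (ha n).2 (hn (ha n).1.2)
  · by_contra! hcon
    choose i M hM hnull using hcon
    obtain ⟨H, hH⟩ := exists_eventual_bound hdom (M := fun β t => C t ∩ M β t)
      fun β t => finite_inter_of_mem_genIdeal (hM β t) (hC t).2
    obtain ⟨t, a, hta, ha⟩ := hP.exists_climb hs
      (R := fun n t => {a ∈ C t | max n (H t) < a}) fun n t ht =>
        let ⟨a, haC, hlt⟩ := (hC t).1.exists_gt (max n (H t))
        ⟨a, hCP t ht haC, haC, hlt⟩
    obtain ⟨β, hβ⟩ := he.splits _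
      (infinite_range_of_le fun n => (le_max_left _ _).trans (ha n).2.le)
    have hbound := hta.injective.tendsto_cofinite.eventually (hH β)
    refine not_splits_range (i := i β) ?_ hβ
    filter_upwards [hnull β t a hta, Nat.cofinite_eq_atTop ▸ hbound] with n hM hlt hmem
    exact (hlt _ ⟨(ha n).1, hM hmem⟩).not_ge ((le_max_right _ _).trans (ha n).2.le)

end SplitSystems

section TaggedFamilies

variable {ι κ : Type} [LinearOrder ι] {e : ι → Set ℕ} {A : κ → Set ℕ} {tag : κ → Tag ι}
  {𝒜 : Set (Set ℕ)} {s t : Tag ι} {X Y Z : Set ℕ}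

/-- The set `Z` follows the tag `t` if it is almost contained in the sides of the sets `e β` that
are given by `t`. -/
def Follows (e : ι → Set ℕ) (t : Tag ι) (Z : Set ℕ) : Prop :=
  ∀ β < t.length, (Z \ side (e β) (t.sign β)).Finite

lemma Follows.finite_inter (hY : Follows e s Y) (hZ : Follows e t Z) (hst : ¬ s ≤ t)
    (hts : ¬ t ≤ s) : (Y ∩ Z).Finite := by
  obtain ⟨β, hs, ht, hsign⟩ := Tag.exists_sign_eq_not hst hts
  refine ((hY β hs).union (hZ β ht)).subset fun n hn => ?_
  by_cases h : n ∈ side (e β) (t.sign β)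
  · exact Or.inl ⟨hn.1, fun h' => mem_side_not.1 (hsign ▸ h') h⟩
  · exact Or.inr ⟨hn.2, h⟩

/-- An almost disjoint family of sets that follow given tags, so that each tag extends the tags of
few members only. -/
structure IsTaggedFamily (e : ι → Set ℕ) (A : κ → Set ℕ) (tag : κ → Tag ι) : Prop where
  infinite : ∀ k, (A k).Infinite
  finite_inter : Pairwise fun k l => (A k ∩ A l).Finite
  follows : ∀ k, Follows e (tag k) (A k)
  card_le : ∀ t, #{k | tag k ≤ t} ≤ max ℵ₀ #(Iic t.length)

lemma IsTaggedFamily.isAD (hA : IsTaggedFamily e A tag) : IsAD (range A) := by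
  refine ⟨forall_mem_range.2 hA.infinite, ?_⟩
  rintro _ ⟨k, rfl⟩ _ ⟨l, rfl⟩ hkl
  exact hA.finite_inter fun h => hkl (h ▸ rfl)

lemma IsTaggedFamily.card_lt (hA : IsTaggedFamily e A tag) (he : IsSplitSystem e) (t : Tag ι) :
    #{k | tag k ≤ t} < splittingNumber :=
  (hA.card_le t).trans_lt (max_lt aleph0_lt_splittingNumber (he.card_Iic _))

lemma IsSplitSystem.exists_follower (he : IsSplitSystem e) (had : IsAD 𝒜)
    (hsa : splittingNumber ≤ almostDisjointnessNumber) (hY : Y ∈ positiveSets 𝒜)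
    (ht : ∀ β < t.length, Y ∩ side (e β) (!t.sign β) ∈ genIdeal 𝒜) {ℬ : Set (Set ℕ)}
    (hℬ : ℬ ⊆ 𝒜) (hcard : #ℬ < splittingNumber) :
    ∃ Z ⊆ Y, Z.Infinite ∧ Follows e t Z ∧ ∀ B ∈ ℬ, (Z ∩ B).Finite := by
  choose F hF hfin hYF using fun β : Iio t.length => ht β β.2
  have hF𝒜 : (⋃ β, F β) ∪ ℬ ⊆ 𝒜 := union_subset (iUnion_subset hF) hℬ
  have hIio : #(Iio t.length) < splittingNumber :=
    (mk_le_mk_of_subset Iio_subset_Iic_self).trans_lt (he.card_Iic t.length)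
  have hFcard : #(⋃ β, F β : Set (Set ℕ)) < splittingNumber :=
    (mk_iUnion_le _).trans_lt (mul_lt_of_lt aleph0_lt_splittingNumber.le hIio
      ((ciSup_le' fun β => (hfin β).countable.le_aleph0).trans_lt aleph0_lt_splittingNumber))
  obtain ⟨Z, hZY, hZ, hZA⟩ := (had.mono hF𝒜).isNowhereMAD_of_card_lt
    (((mk_union_le _ _).trans_lt
      (add_lt_of_lt aleph0_lt_splittingNumber.le hFcard hcard)).trans_le hsa)
    Y (positiveSets_anti hF𝒜 hY)
  refine ⟨Z, hZY, hZ, fun β hβ => ?_, fun B hB => hZA B (Or.inr hB)⟩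
  refine finite_of_finite_diff_of_finite_inter (Y := ⋃₀ F ⟨β, hβ⟩)
    ((hYF ⟨β, hβ⟩).subset fun n hn => ⟨⟨hZY hn.1.1, mem_side_not.2 hn.1.2⟩, hn.2⟩)
    ((finite_inter_sUnion (hfin ⟨β, hβ⟩) fun B hB => hZA B (Or.inl (mem_iUnion.2 ⟨_, hB⟩))).subset
      (inter_subset_inter_left _ sdiff_subset))

variable [WellFoundedLT ι]

/-- The notion of splitting for positive sets: a positive set is hit where its trace is positive. -/
def IsSplitSystem.positiveSplitNotion (he : IsSplitSystem e) (had : IsAD 𝒜) :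
    SplitNotion (positiveSets 𝒜) ι where
  hit Y β i := Y.1 ∩ side (e β) i ∈ positiveSets 𝒜
  hit_or_hit_not Y β i := by
    by_contra! hcon
    refine Y.2 (mem_genIdeal_of_subset
      (union_mem_genIdeal (not_not.1 hcon.1) (not_not.1 hcon.2)) fun n hn => ?_)
    by_cases h : n ∈ side (e β) i
    · exact Or.inl ⟨hn, h⟩
    · exact Or.inr ⟨hn, mem_side_not.2 h⟩
  exists_hit Y := he.exists_split_positive had Y.2

lemma IsSplitSystem.step_inter_side (he : IsSplitSystem e) (had : IsAD 𝒜)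
    {Y Z : positiveSets 𝒜} {i : Bool} (h : Z.1 =
      Y.1 ∩ side (e ((he.positiveSplitNotion had).tag Y).length) i) :
    (he.positiveSplitNotion had).Step Y i Z := by
  refine ⟨fun β j hj => positive_of_subset hj (inter_subset_inter_left _ ?_), not_not_intro ?_⟩
  · exact h ▸ inter_subset_left
  · rw [h]
    refine mem_genIdeal_of_finite (finite_empty.subset ?_)
    exact fun n hn => mem_side_not.1 hn.2 hn.1.2

lemma IsSplitSystem.exists_fresh_positive (he : IsSplitSystem e) (had : IsAD 𝒜) (hκ : #κ < 𝔠)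
    (tag : κ → Tag ι) (hX : X ∈ positiveSets 𝒜) :
    ∃ Y ⊆ X, Y ∈ positiveSets 𝒜 ∧ ∃ t : Tag ι, (∀ k, ¬ t ≤ tag k) ∧
      ∀ β < t.length, Y ∩ side (e β) (!t.sign β) ∈ genIdeal 𝒜 := by
  let N := he.positiveSplitNotion had
  let cond : List Bool → positiveSets 𝒜 := fun u =>
    u.rec ⟨X, hX⟩ fun i _ Y => ⟨Y.1 ∩ side (e (N.tag Y).length) i, N.hit_length Y i⟩
  obtain ⟨x, t, hle, hlim, hfresh⟩ := Tag.exists_fresh_branch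
    (fun u i => (he.step_inter_side had (Y := cond u) (Z := cond (i :: u)) rfl).isStep_tag)
    he.bounded hκ tag
  obtain ⟨Y, hYX, hY, hdiff⟩ := exists_positive_pseudoIntersection had
    (X := fun n => (cond (PiNat.res x n)).1) (antitone_nat_of_succ_le fun n => inter_subset_left)
    fun n => (cond (PiNat.res x n)).2
  refine ⟨Y, hYX, hY, t, hfresh, fun β hβ => ?_⟩
  obtain ⟨n, hn⟩ := hlim β hβ
  have hnull : (cond (PiNat.res x n)).1 ∩ side (e β) (!t.sign β) ∈ genIdeal 𝒜 := by
    rw [← (hle n).2 β hn]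
    exact not_not.1 (N.not_hit_of_lt hn)
  refine mem_genIdeal_of_subset (union_mem_genIdeal hnull (mem_genIdeal_of_finite (hdiff n))) ?_
  intro m hm
  by_cases h : m ∈ (cond (PiNat.res x n)).1
  · exact Or.inl ⟨h, hm.2⟩
  · exact Or.inr ⟨hm.1, h⟩

lemma IsTaggedFamily.exists_fresh_subset (hA : IsTaggedFamily e A tag) (he : IsSplitSystem e)
    (hsa : splittingNumber ≤ almostDisjointnessNumber) (hκ : #κ < 𝔠)
    (hX : X ∈ positiveSets (range A)) :
    ∃ Z ⊆ X, Z.Infinite ∧ (∀ k, (Z ∩ A k).Finite) ∧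
      ∃ t, Follows e t Z ∧ ∀ k, ¬ t ≤ tag k := by
  obtain ⟨Y, hYX, hY, t, hfresh, hnull⟩ := he.exists_fresh_positive hA.isAD hκ tag hX
  obtain ⟨Z, hZY, hZ, hZt, hZA⟩ := he.exists_follower hA.isAD hsa hY hnull
    (image_subset_range A {k | tag k ≤ t}) (mk_image_le.trans_lt (hA.card_lt he t))
  refine ⟨Z, hZY.trans hYX, hZ, fun k => ?_, t, hZt, hfresh⟩
  by_cases hk : tag k ≤ t
  · exact hZA _ (mem_image_of_mem A hk)
  · exact hZt.finite_inter (hA.follows k) (hfresh k) hk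

lemma IsTaggedFamily.isNowhereMAD (hA : IsTaggedFamily e A tag) (he : IsSplitSystem e)
    (hsa : splittingNumber ≤ almostDisjointnessNumber) (hκ : #κ < 𝔠) :
    IsNowhereMAD (range A) := fun _ hX =>
  let ⟨Z, hZX, hZ, hZA, _⟩ := hA.exists_fresh_subset he hsa hκ hX
  ⟨Z, hZX, hZ, forall_mem_range.2 hZA⟩

end TaggedFamilies

section RootedConditions

variable {ι : Type} [LinearOrder ι] [WellFoundedLT ι] {e : ι → Set ℕ} {𝒜 : Set (Set ℕ)}

/-- A condition together with one of its nodes; only the nodes above this root matter. -/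
structure RootedCondition (𝒜 : Set (Set ℕ)) where
  nodes : Set (List ℕ)
  root : List ℕ
  isCondition : IsCondition 𝒜 nodes
  root_mem : root ∈ nodes

/-- A descent through the rooted conditions `p n` along a climb: each condition is contained in the
previous one, and its root is the next node of the climb. -/
structure IsDescent (p : ℕ → RootedCondition 𝒜) (t : ℕ → List ℕ) (a : ℕ → ℕ) : Prop where
  root_prefix : ∀ n, (p n).root <+: t n
  root_succ : ∀ n, (p (n + 1)).root = t n ++ [a n]
  nodes_succ_subset : ∀ n, (p (n + 1)).nodes ⊆ (p n).nodes

lemma IsDescent.isClimb {p : ℕ → RootedCondition 𝒜} {t : ℕ → List ℕ} {a : ℕ → ℕ}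
    (h : IsDescent p t a) (n : ℕ) :
    IsClimb (p n).nodes (p n).root (fun k => t (k + n)) fun k => a (k + n) where
  prefix_zero := by
    rw [zero_add]
    exact h.root_prefix n
  mem k := by
    rw [← h.root_succ]
    exact antitone_nat_of_succ_le (f := fun n => (p n).nodes) h.nodes_succ_subset (by omega)
      (p _).root_mem
  prefix_succ k := by
    rw [← h.root_succ, Nat.add_right_comm]
    exact h.root_prefix _

/-- The notion of splitting for rooted conditions: a condition is hit on the sides that are not
null above its root. -/
def IsSplitSystem.conditionSplitNotion (he : IsSplitSystem e) (hnm : IsNowhereMAD 𝒜) :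
    SplitNotion (RootedCondition 𝒜) ι where
  hit p β i := ¬ IsNullAbove 𝒜 p.nodes (side (e β) i) p.root
  hit_or_hit_not p β i := by
    rw [← compl_side, or_iff_not_imp_left, not_not]
    exact p.isCondition.not_isNullAbove_compl p.root_mem
  exists_hit p := he.exists_split_condition hnm p.isCondition p.root_mem

lemma IsSplitSystem.exists_next (he : IsSplitSystem e) (hnm : IsNowhereMAD 𝒜)
    (p : RootedCondition 𝒜) (i : Bool) :
    ∃ (t : List ℕ) (C : Set ℕ) (q : ℕ → RootedCondition 𝒜),
      p.root <+: t ∧ (C.Infinite ∧ ∀ A ∈ 𝒜, (C ∩ A).Finite) ∧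
      ∀ a ∈ C, (q a).root = t ++ [a] ∧ (q a).nodes ⊆ p.nodes ∧
        (he.conditionSplitNotion hnm).Step p i (q a) := by
  set N := he.conditionSplitNotion hnm
  obtain ⟨t, ht, hpos⟩ := exists_positive_kernel (N.hit_length p i)
  obtain ⟨C, hCK, hC⟩ := hnm _ hpos
  have hq : ∀ a ∈ C, ∃ q : RootedCondition 𝒜, q.root = t ++ [a] ∧ q.nodes ⊆ p.nodes ∧
      N.Step p i q := fun a ha => by
    refine ⟨⟨_, t ++ [a], isCondition_kernel, hCK ha⟩, rfl, kernel_subset, ?_, ?_⟩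
    · exact fun β j => mt fun h => h.mono kernel_subset (ht.trans (List.prefix_append _ _))
    · exact not_not_intro (isNullAbove_kernel
        (Set.disjoint_left.2 fun _ h h' => mem_side_not.1 h' h))
  have : Nonempty (RootedCondition 𝒜) := ⟨p⟩
  choose! q hq using hq
  exact ⟨t, C, q, ht, hC, hq⟩

/-- All plays start at `p₀` and descend through countably many rooted conditions; these are known
before the rules `R`, which the entries along each play have to obey, are chosen. -/
lemma IsSplitSystem.exists_scheme (he : IsSplitSystem e) (hnm : IsNowhereMAD 𝒜)
    (p₀ : RootedCondition 𝒜) :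
    ∃ 𝒮 : Set (RootedCondition 𝒜), 𝒮.Countable ∧ p₀ ∈ 𝒮 ∧
      ∀ {J : Type} {R : J → List ℕ → Set ℕ}, #J < splittingNumber →
        (∀ j t, R j t ∈ genIdeal 𝒜) →
        ∃ p : List Bool → RootedCondition 𝒜, p [] = p₀ ∧ (∀ u, p u ∈ 𝒮) ∧
          (∀ u i, (he.conditionSplitNotion hnm).Step (p u) i (p (i :: u))) ∧
          ∀ x : ℕ → Bool, ∃ (t : ℕ → List ℕ) (a : ℕ → ℕ),
            IsDescent (fun n => p (PiNat.res x n)) t a ∧ (∀ n, n ≤ a n) ∧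
              ∀ E : Finset J, ∃ᶠ n in atTop, ∀ j ∈ E, a n ∉ R j (t n) := by
  choose t C q hroot hC hq using he.exists_next hnm
  let cond : List (Bool × ℕ) → RootedCondition 𝒜 := fun θ => θ.foldr (fun c p => q p c.1 c.2) p₀
  refine ⟨range cond, countable_range cond, ⟨[], rfl⟩, fun {J R} hJ hR => ?_⟩
  obtain ⟨move, hmove, hplay⟩ := exists_moves (Q := List (Bool × ℕ) × Bool) hJ
    (Z := fun θ => C (cond θ.1) θ.2) (fun θ => (hC _ _).1)
    (succ := fun θ a => range fun j => ((θ.2, a) :: θ.1, j)) (fun θ a => finite_range _)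
    (M := fun j θ => R j (t (cond θ.1) θ.2))
    fun j θ => finite_inter_of_mem_genIdeal (hR j _) (hC _ _).2
  let hist : List Bool → List (Bool × ℕ) := fun u =>
    u.rec [] fun i u θ => (i, move u.length (θ, i)) :: θ
  let play (x : ℕ → Bool) (n : ℕ) : List (Bool × ℕ) × Bool := (hist (PiNat.res x n), x n)
  have hhist : ∀ x n, hist (PiNat.res x (n + 1)) =
      (x n, move n (play x n)) :: hist (PiNat.res x n) := fun x n => by
    simp only [hist, play, PiNat.res_succ, PiNat.res_length]
  have hdescent : ∀ x, IsDescent (fun n => cond (hist (PiNat.res x n)))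
      (fun n => t (cond (play x n).1) (x n)) fun n => move n (play x n) := fun x =>
    ⟨fun n => hroot _ _,
      fun n => by simp only [hhist]; exact (hq _ _ _ (hmove n (play x n)).1).1,
      fun n => by simp only [hhist]; exact (hq _ _ _ (hmove n (play x n)).1).2.1⟩
  refine ⟨fun u => cond (hist u), rfl, fun u => mem_range_self _,
    fun u i => (hq _ _ _ (hmove u.length (hist u, i)).1).2.2, fun x => ⟨_, _, hdescent x,
      fun n => (hmove n _).2, hplay (play x) fun n => ⟨x (n + 1), ?_⟩⟩⟩
  simp only [play, hhist]

end RootedConditions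

section PositiveBranch

variable {ι κ : Type} [LinearOrder ι] {e : ι → Set ℕ} {A : κ → Set ℕ}
  {tag : κ → Tag ι}

lemma IsTaggedFamily.card_sigma_lt (hA : IsTaggedFamily e A tag) (he : IsSplitSystem e) {S : Type}
    [Countable S] [Nonempty S] (τ : S → Tag ι) :
    #(Σ p, Iio (τ p).length ⊕ {k | tag k ≤ τ p}) < splittingNumber := by
  obtain ⟨φ, hφ⟩ := exists_surjective_nat S
  obtain ⟨b, hb⟩ := he.bounded fun n => (τ (φ n)).length
  have hIic : ∀ p, #(Iic (τ p).length) ≤ #(Iic b) := fun p =>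
    let ⟨n, hn⟩ := hφ p
    mk_le_mk_of_subset (Iic_subset_Iic.2 (hn ▸ (hb n).le))
  have hle : ∀ p, #(Iio (τ p).length ⊕ {k | tag k ≤ τ p}) ≤ max ℵ₀ #(Iic b) := fun p => by
    rw [mk_sum, lift_id, lift_id]
    exact add_le_of_le (le_max_left _ _)
      (((mk_le_mk_of_subset Iio_subset_Iic_self).trans (hIic p)).trans (le_max_right _ _))
      ((hA.card_le _).trans (max_le_max_left _ (hIic p)))
  rw [mk_sigma]
  exact (sum_le_mk_mul_iSup _).trans_lt (mul_lt_of_lt aleph0_lt_splittingNumber.le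
    (mk_le_aleph0.trans_lt aleph0_lt_splittingNumber)
    ((ciSup_le' hle).trans_lt (max_lt aleph0_lt_splittingNumber (he.card_Iic b))))

lemma Follows.eventually_mem_side {t : Tag ι} {Z : Set ℕ} (hZ : Follows e t Z) {β : ι}
    (hβ : β < t.length) {a : ℕ → ℕ} (hle : ∀ n, n ≤ a n) :
    ∀ᶠ n in atTop, a n ∈ Z → a n ∈ side (e β) (t.sign β) :=
  (eventually_notMem_of_finite hle (hZ β hβ)).mono fun _ h hn => by_contra fun h' => h ⟨hn, h'⟩

/-- The climb follows a fresh limit tag `t`, apart from entries in the sets `R j n`, any finitely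
many of which it avoids infinitely often at once. -/
lemma IsTaggedFamily.exists_tagged_climb [WellFoundedLT ι] (hA : IsTaggedFamily e A tag)
    (he : IsSplitSystem e) (hnm : IsNowhereMAD (range A)) (hκ : #κ < 𝔠)
    (p₀ : RootedCondition (range A)) :
    ∃ (s : ℕ → List ℕ) (a : ℕ → ℕ) (t : Tag ι) (J : Type) (R : J → ℕ → Set ℕ),
      IsClimb p₀.nodes p₀.root s a ∧ (∀ n, n ≤ a n) ∧ (∀ k, ¬ t ≤ tag k) ∧
      (∀ E : Finset J, ∃ᶠ n in atTop, ∀ j ∈ E, a n ∉ R j n) ∧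
      (∀ k, tag k ≤ t → ∃ j, ∀ n, R j n = A k) ∧
      ∀ β < t.length, ∃ j, ∀ᶠ n in atTop, a n ∈ side (e β) (!t.sign β) → a n ∈ R j n := by
  let N := he.conditionSplitNotion hnm
  obtain ⟨𝒮, h𝒮, hp₀, hscheme⟩ := he.exists_scheme hnm p₀
  have := h𝒮.to_subtype
  have : Nonempty 𝒮 := ⟨⟨p₀, hp₀⟩⟩
  choose M hM hnull using fun (p : 𝒮) (β : Iio (N.tag p.1).length) =>
    not_not.1 (N.not_hit_of_lt β.2)
  let R : (Σ p : 𝒮, Iio (N.tag p.1).length ⊕ {k | tag k ≤ N.tag p.1}) → List ℕ → Set ℕ :=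
    fun j => j.2.elim (M j.1) fun k _ => A k
  have hR : ∀ j u, R j u ∈ genIdeal (range A) := by
    rintro ⟨p, β | k⟩ u
    · exact hM p β u
    · exact mem_genIdeal_of_mem (mem_range_self k.1)
  obtain ⟨p, rfl, hp, hstep, hplay⟩ := hscheme (hA.card_sigma_lt he _) hR
  obtain ⟨x, t, hle, hlim, hfresh⟩ :=
    Tag.exists_fresh_branch (fun u i => (hstep u i).isStep_tag) he.bounded hκ tag
  obtain ⟨s, a, hdescent, hna, havoid⟩ := hplay x
  refine ⟨s, a, t, _, fun j n => R j (s n), hdescent.isClimb 0, hna, hfresh, havoid,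
    fun k hk => ?_, fun β hβ => ?_⟩
  · have hlt : (tag k).length < t.length :=
      lt_of_not_ge fun h => hfresh k (Tag.le_of_length_le le_rfl hk h)
    obtain ⟨n, hn⟩ := hlim _ hlt
    exact ⟨⟨⟨_, hp (PiNat.res x n)⟩, Sum.inr ⟨k, Tag.le_of_length_le hk (hle n) hn.le⟩⟩,
      fun _ => rfl⟩
  · obtain ⟨n, hn⟩ := hlim β hβ
    refine ⟨⟨⟨_, hp (PiNat.res x n)⟩, Sum.inl ⟨β, hn⟩⟩, ?_⟩
    rw [← (hle n).2 β hn, ← map_add_atTop_eq_nat n, eventually_map]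
    exact hnull ⟨_, hp (PiNat.res x n)⟩ ⟨β, hn⟩ _ _ (hdescent.isClimb n)

theorem IsTaggedFamily.exists_positive_branch [WellFoundedLT ι] (hA : IsTaggedFamily e A tag)
    (he : IsSplitSystem e) (hsa : splittingNumber ≤ almostDisjointnessNumber) (hκ : #κ < 𝔠)
    {T : Descriptive.tree ℕ} (hT : IsBranchingTree (positiveSets (range A)) T) :
    ∃ f ∈ treeBranches T, range f ∈ positiveSets (range A) := by
  obtain ⟨s, a, t, J, R, hclimb, hna, hfresh, havoid, hRA, hRside⟩ :=
    hA.exists_tagged_climb he (hA.isNowhereMAD he hsa hκ) hκ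
      ⟨{s | s ∈ T}, [], fun s hs => ⟨s, List.prefix_rfl, hT.2 s hs⟩, hT.1⟩
  obtain ⟨f, hf, haf⟩ := hclimb.exists_branch
  refine ⟨f, hf, positive_of_subset
    (range_mem_positiveSets hna (forall_mem_range.2 fun k => ?_) havoid) haf⟩
  by_cases hk : tag k ≤ t
  · obtain ⟨j, hj⟩ := hRA k hk
    exact ⟨j, Eventually.of_forall fun n h => hj n ▸ h⟩
  · obtain ⟨β, hβk, hβt, hsign⟩ := Tag.exists_sign_eq_not hk (hfresh k)
    obtain ⟨j, hj⟩ := hRside β hβt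
    refine ⟨j, ?_⟩
    filter_upwards [hj, (hA.follows k).eventually_mem_side hβk hna] with n hjn hside hn
    exact hjn (hsign ▸ hside hn)

end PositiveBranch

section Construction

variable {ι Γ Δ : Type} [LinearOrder ι] [LinearOrder Δ] {e : ι → Set ℕ} {𝒜 : Set (Set ℕ)}

lemma isAD_range_piece {Z : Set ℕ} (hZ : Z.Infinite) : IsAD (range (piece Z)) := by
  refine ⟨forall_mem_range.2 (infinite_piece hZ), ?_⟩
  rintro _ ⟨i, rfl⟩ _ ⟨j, rfl⟩ hij
  simp only [(disjoint_piece hZ fun h => hij (congrArg _ h)).inter_eq, finite_empty]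

lemma IsAD.positive_of_range_piece_subset (had : IsAD 𝒜) {Z : Set ℕ} (hZ : Z.Infinite)
    (h : range (piece Z) ⊆ 𝒜) : Z ∈ positiveSets 𝒜 := by
  refine positive_of_infinite_hits had
    ((infinite_range_of_injective (piece_injective hZ)).mono fun A hA => ⟨h hA, ?_⟩)
  obtain ⟨j, rfl⟩ := hA
  exact (infinite_piece hZ j).mono (subset_inter (piece_subset hZ j) subset_rfl)

lemma IsAD.maximal_of_isCompletelySeparable (had : IsAD 𝒜) (h : IsCompletelySeparable 𝒜) :
    Maximal IsAD 𝒜 := by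
  refine had.maximal_of_forall_exists fun X hX => ?_
  by_contra! hcon
  obtain ⟨A, hA, hAX⟩ := h X (positive_of_almostDisjoint hX hcon)
  exact had.1 A hA (inter_eq_right.2 hAX ▸ hcon A hA)

lemma exists_isBranchingTree_of_mem {𝒳 : Set (Set ℕ)} {X : Set ℕ} (hX : X ∈ 𝒳) :
    ∃ T, IsBranchingTree 𝒳 T ∧ ∀ f ∈ treeBranches T, range f ⊆ X := by
  refine ⟨⟨{s | ∀ n ∈ s, n ∈ X}, fun s n h m hm => h m (List.mem_append_left _ hm)⟩,
    ⟨fun _ hn => absurd hn List.not_mem_nil, fun s hs => ?_⟩, fun f hf => ?_⟩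
  · convert hX
    ext n
    exact ⟨fun h => h n (by simp), fun hn m hm => by
      rcases List.mem_append.1 hm with hm | hm
      · exact hs m hm
      · exact List.mem_singleton.1 hm ▸ hn⟩
  · rintro _ ⟨n, rfl⟩
    exact hf (n + 1) (f n) (List.mem_map_of_mem (List.mem_range.2 n.lt_succ_self))

/-- The family of all pieces of the sets in a family of tagged sets. -/
noncomputable def pieces (F : Γ → Set ℕ × Tag ι) (c : Γ × ℕ) : Set ℕ :=
  piece (F c.1).1 c.2

/-- The requirements on the tagged set `o` that is added to the tagged sets `F` in one stage of the
construction, which deals with the tree `T`. -/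
structure IsExtension (e : ι → Set ℕ) (F : Γ → Set ℕ × Tag ι) (T : Descriptive.tree ℕ)
    (o : Set ℕ × Tag ι) : Prop where
  infinite : o.1.Infinite
  finite_inter : ∀ c, (o.1 ∩ pieces F c).Finite
  follows : Follows e o.2 o.1
  fresh : ∀ γ, ¬ o.2 ≤ (F γ).2
  exists_branch : IsBranchingTree (positiveSets (range (pieces F))) T →
    ∃ f ∈ treeBranches T, o.1 ⊆ range f

lemma IsTaggedFamily.univ_positive {F : Γ → Set ℕ × Tag ι}
    (hF : IsTaggedFamily e (pieces F) fun c => (F c.1).2) (hinf : ∀ γ, (F γ).1.Infinite) :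
    Set.univ ∈ positiveSets (range (pieces F)) := by
  rcases isEmpty_or_nonempty Γ with hΓ | ⟨⟨γ⟩⟩
  · exact positive_of_almostDisjoint infinite_univ (forall_mem_range.2 isEmptyElim)
  · refine positive_of_subset (hF.isAD.positive_of_range_piece_subset (hinf γ) ?_)
      (subset_univ _)
    exact range_subset_iff.2 fun j => ⟨(γ, j), rfl⟩

lemma IsTaggedFamily.exists_isExtension [WellFoundedLT ι] {F : Γ → Set ℕ × Tag ι}
    (hF : IsTaggedFamily e (pieces F) fun c => (F c.1).2) (hinf : ∀ γ, (F γ).1.Infinite)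
    (he : IsSplitSystem e) (hsa : splittingNumber ≤ almostDisjointnessNumber) (hΓ : #Γ < 𝔠)
    (T : Descriptive.tree ℕ) : ∃ o, IsExtension e F T o := by
  have hcard : #(Γ × ℕ) < 𝔠 := by
    rw [mk_prod, lift_id, lift_id, mk_nat]
    exact mul_lt_of_lt aleph0_le_continuum hΓ aleph0_lt_continuum
  obtain ⟨X, hX, hXT⟩ : ∃ X ∈ positiveSets (range (pieces F)),
      IsBranchingTree (positiveSets (range (pieces F))) T →
        ∃ f ∈ treeBranches T, X ⊆ range f := by
    by_cases hT : IsBranchingTree (positiveSets (range (pieces F))) T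
    · obtain ⟨f, hf, hpos⟩ := hF.exists_positive_branch he hsa hcard hT
      exact ⟨range f, hpos, fun _ => ⟨f, hf, subset_rfl⟩⟩
    · exact ⟨univ, hF.univ_positive hinf, fun h => absurd h hT⟩
  obtain ⟨Z, hZX, hZ, hZA, t, hZt, hfresh⟩ := hF.exists_fresh_subset he hsa hcard hX
  exact ⟨(Z, t), hZ, hZA, hZt, fun γ => hfresh (γ, 0),
    fun hT => (hXT hT).imp fun f hf => ⟨hf.1, hZX.trans hf.2⟩⟩

section Stages

variable {F : Δ → Set ℕ × Tag ι} {T : Δ → Descriptive.tree ℕ} {s : Set Δ}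

lemma finite_inter_of_isExtension
    (h : ∀ δ ∈ s, IsExtension e (fun γ : Iio δ => F γ) (T δ) (F δ)) :
    Pairwise fun c d : s × ℕ =>
      (pieces (fun γ : s => F γ) c ∩ pieces (fun γ : s => F γ) d).Finite := by
  have hlt : ∀ (γ δ : s) (i j : ℕ), γ < δ → (piece (F δ).1 j ∩ piece (F γ).1 i).Finite :=
    fun γ δ i j hγδ => ((h δ δ.2).finite_inter (⟨γ, hγδ⟩, i)).subset
      (inter_subset_inter_left _ (piece_subset (h δ δ.2).infinite j))
  rintro ⟨γ, i⟩ ⟨δ, j⟩ hne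
  rcases lt_trichotomy γ δ with hγδ | rfl | hδγ
  · exact inter_comm _ _ ▸ hlt γ δ i j hγδ
  · have hij : i ≠ j := fun hij => hne (hij ▸ rfl)
    exact (disjoint_piece (h γ γ.2).infinite hij).inter_eq ▸ finite_empty
  · exact hlt δ γ j i hδγ

lemma card_tag_le_of_isExtension
    (h : ∀ δ ∈ s, IsExtension e (fun γ : Iio δ => F γ) (T δ) (F δ)) (t : Tag ι) :
    #{c : s × ℕ | (F c.1).2 ≤ t} ≤ max ℵ₀ #(Iic t.length) := by
  have hlt : ∀ γ δ : s, (F γ).2 ≤ t → (F δ).2 ≤ t → γ < δ →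
      (F γ).2.length ≠ (F δ).2.length := fun γ δ hγ hδ hγδ heq =>
    (h δ δ.2).fresh ⟨γ, hγδ⟩ (Tag.le_of_length_le hδ hγ heq.ge)
  let φ : {c : s × ℕ | (F c.1).2 ≤ t} → Iic t.length × ℕ :=
    fun c => (⟨(F c.1.1).2.length, c.2.1⟩, c.1.2)
  have hφ : Function.Injective φ := by
    rintro ⟨⟨γ, i⟩, hγ⟩ ⟨⟨δ, j⟩, hδ⟩ heq
    obtain ⟨hlen, rfl⟩ := Prod.ext_iff.1 heq
    have hlen : (F γ).2.length = (F δ).2.length := congrArg Subtype.val hlen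
    rcases lt_trichotomy γ δ with hγδ | rfl | hδγ
    · exact absurd hlen (hlt γ δ hγ hδ hγδ)
    · rfl
    · exact absurd hlen.symm (hlt δ γ hδ hγ hδγ)
  refine (mk_le_of_injective hφ).trans ?_
  rw [mk_prod, lift_id, lift_id, mk_nat, max_comm]
  exact mul_le_max_of_aleph0_le_right le_rfl

lemma isTaggedFamily_of_isExtension
    (h : ∀ δ ∈ s, IsExtension e (fun γ : Iio δ => F γ) (T δ) (F δ)) :
    IsTaggedFamily e (pieces fun γ : s => F γ) fun c => (F c.1).2 where
  infinite c := infinite_piece (h _ c.1.2).infinite c.2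
  finite_inter := finite_inter_of_isExtension h
  follows c β hβ := ((h _ c.1.2).follows β hβ).subset
    (sdiff_subset_sdiff_left (piece_subset (h _ c.1.2).infinite c.2))
  card_le := card_tag_le_of_isExtension h

lemma IsSplitSystem.exists_isExtension [WellFoundedLT ι] [WellFoundedLT Δ] (he : IsSplitSystem e)
    (hsa : splittingNumber ≤ almostDisjointnessNumber) (hΔ : ∀ δ : Δ, #(Iio δ) < 𝔠)
    (T : Δ → Descriptive.tree ℕ) :
    ∃ F : Δ → Set ℕ × Tag ι, ∀ δ, IsExtension e (fun γ : Iio δ => F γ) (T δ) (F δ) := by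
  obtain ⟨b, -⟩ := he.bounded fun _ => (he.splits univ infinite_univ).choose
  have : Nonempty (Set ℕ × Tag ι) := ⟨(∅, ⟨b, fun _ => true⟩)⟩
  have hwf : WellFounded ((· < ·) : Δ → Δ → Prop) := wellFounded_lt
  let F : Δ → Set ℕ × Tag ι := hwf.fix fun δ rec =>
    Classical.epsilon (IsExtension e (fun γ : Iio δ => rec γ.1 γ.2) (T δ))
  have hF : ∀ δ, F δ = Classical.epsilon (IsExtension e (fun γ : Iio δ => F γ) (T δ)) :=
    fun δ => hwf.fix_eq _ δ
  refine ⟨F, fun δ => ?_⟩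
  induction δ using hwf.induction with
  | _ δ ih =>
    rw [hF δ]
    exact Classical.epsilon_spec ((isTaggedFamily_of_isExtension ih).exists_isExtension
      (fun γ => (ih γ γ.2).infinite) he hsa (hΔ δ) (T δ))

end Stages

lemma exists_enumeration_trees :
    ∃ (Δ : Type) (_ : LinearOrder Δ) (_ : WellFoundedLT Δ) (T : Δ → Descriptive.tree ℕ),
      (∀ δ : Δ, #(Iio δ) < 𝔠) ∧ Function.Surjective T := by
  have hcard : #((𝔠 : Cardinal.{0}).ord.ToType) = 𝔠 := mk_ord_toType _
  have htrees : #(Descriptive.tree ℕ) ≤ 𝔠 := by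
    simpa only [mk_set, mk_list_eq_aleph0, two_power_aleph0] using
      mk_subtype_le (α := Set (List ℕ)) (· ∈ Descriptive.tree ℕ)
  obtain ⟨φ⟩ : #(Descriptive.tree ℕ) ≤ #((𝔠 : Cardinal.{0}).ord.ToType) := by
    rwa [hcard]
  have : Nonempty (Descriptive.tree ℕ) := ⟨⊤⟩
  refine ⟨_, _, inferInstance, _, fun δ => ?_, Function.invFun_surjective φ.injective⟩
  simpa only [hcard] using mk_Iio_lt δ (by rw [hcard, Ordinal.type_toType])

lemma exists_isAD_dense_branches (hsa : splittingNumber ≤ almostDisjointnessNumber) :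
    ∃ 𝒜, IsAD 𝒜 ∧ 𝒜.Infinite ∧ ∀ T, IsBranchingTree (positiveSets 𝒜) T →
      ∃ f ∈ treeBranches T, ∃ Z ⊆ range f, Z.Infinite ∧ range (piece Z) ⊆ 𝒜 := by
  obtain ⟨ι, _, _, e, he⟩ := exists_isSplitSystem
  obtain ⟨Δ, _, _, T, hΔ, hT⟩ := exists_enumeration_trees
  obtain ⟨F, hF⟩ := he.exists_isExtension hsa hΔ T
  have hpieces : ∀ δ, range (piece (F δ).1) ⊆ range (pieces fun γ : (univ : Set Δ) => F γ) :=
    fun δ => range_subset_iff.2 fun j => ⟨(⟨δ, mem_univ δ⟩, j), rfl⟩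
  refine ⟨_, (isTaggedFamily_of_isExtension fun δ (_ : δ ∈ Set.univ) => hF δ).isAD, ?_,
    fun T' hT' => ?_⟩
  · obtain ⟨δ, -⟩ := hT ⊤
    exact (infinite_range_of_injective (piece_injective (hF δ).infinite)).mono (hpieces δ)
  · obtain ⟨δ, rfl⟩ := hT T'
    have hsub : range (pieces fun γ : Iio δ => F γ) ⊆
        range (pieces fun γ : (univ : Set Δ) => F γ) :=
      range_subset_iff.2 fun c => hpieces c.1 (mem_range_self c.2)
    obtain ⟨f, hf, hFf⟩ :=
      (hF δ).exists_branch ⟨hT'.1, fun s hs => positiveSets_anti hsub (hT'.2 s hs)⟩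
    exact ⟨f, hf, _, hFf, (hF δ).infinite, hpieces δ⟩

theorem exists_isMAD_isPlusRamsey_isCompletelySeparable
    (hsa : splittingNumber ≤ almostDisjointnessNumber) :
    ∃ 𝒜 : Set (Set ℕ), IsMAD 𝒜 ∧ IsPlusRamsey 𝒜 ∧ IsCompletelySeparable 𝒜 := by
  obtain ⟨𝒜, had, hinf, hdense⟩ := exists_isAD_dense_branches hsa
  have hcs : IsCompletelySeparable 𝒜 := fun X hX => by
    obtain ⟨T, hT, hTX⟩ := exists_isBranchingTree_of_mem hX
    obtain ⟨f, hf, Z, hZf, hZ, hpieces⟩ := hdense T hT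
    exact ⟨_, hpieces (mem_range_self 0), (piece_subset hZ 0).trans (hZf.trans (hTX f hf))⟩
  refine ⟨𝒜, ⟨hinf, had.maximal_of_isCompletelySeparable hcs⟩, fun T hT => ?_, hcs⟩
  obtain ⟨f, hf, Z, hZf, hZ, hpieces⟩ := hdense T hT
  exact ⟨f, hf, positive_of_subset (had.positive_of_range_piece_subset hZ hpieces) hZf⟩

lemma isAD_sUnion {c : Set (Set (Set ℕ))} (hc : ∀ 𝒜 ∈ c, IsAD 𝒜) (hchain : IsChain (· ⊆ ·) c) :
    IsAD (⋃₀ c) :=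
  ⟨fun A ⟨𝒜, h𝒜, hA⟩ => (hc 𝒜 h𝒜).1 A hA,
    (pairwise_sUnion hchain.directedOn).2 fun 𝒜 h𝒜 => (hc 𝒜 h𝒜).2⟩

lemma exists_isMAD_card_eq : ∃ 𝒜 : Set (Set ℕ), IsMAD 𝒜 ∧ #𝒜 = almostDisjointnessNumber := by
  obtain ⟨𝒜, hsub, hmax⟩ := zorn_subset_nonempty {𝒜 | IsAD 𝒜}
    (fun c hc hchain _ => ⟨⋃₀ c, isAD_sUnion hc hchain, fun _ => subset_sUnion_of_mem⟩) _
    (isAD_range_piece infinite_univ)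
  exact csInf_mem (s := {κ | ∃ 𝒜 : Set (Set ℕ), IsMAD 𝒜 ∧ #𝒜 = κ})
    ⟨_, 𝒜, ⟨(infinite_range_of_injective (piece_injective infinite_univ)).mono hsub, hmax⟩, rfl⟩

end Construction

theorem theorem23 :
    (∃ 𝒜 : Set (Set ℕ), IsMAD 𝒜 ∧ IsPlusRamsey 𝒜) ∧
    (splittingNumber ≤ almostDisjointnessNumber →
      ∃ 𝒜 : Set (Set ℕ), IsMAD 𝒜 ∧ IsPlusRamsey 𝒜 ∧ IsCompletelySeparable 𝒜) := by
  refine ⟨?_, exists_isMAD_isPlusRamsey_isCompletelySeparable⟩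
  rcases le_or_gt splittingNumber almostDisjointnessNumber with h | h
  · obtain ⟨𝒜, h𝒜, hramsey, -⟩ := exists_isMAD_isPlusRamsey_isCompletelySeparable h
    exact ⟨𝒜, h𝒜, hramsey⟩
  · obtain ⟨𝒜, h𝒜, hcard⟩ := exists_isMAD_card_eq
    exact ⟨𝒜, h𝒜, h𝒜.isPlusRamsey_of_card_lt (hcard ▸ h)⟩
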